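/- Let $n\ge 1$. A \emph{$c$-frame} in $\mathbb{R}^{n+1}$ consists of a line $L$, of $n$ pairwise non-parallel planes $P_1,\dots,P_n$ containing $L$, of a finite non-empty set $V\subset L$ of nodes, and, in every plane $P_i$, of a family of circles such that every circle contains exactly two nodes, which are the ends of a diameter of it, every node lies on exactly one circle of each plane $P_i$, different circles meet only in nodes, and the bundle is connected (any two nodes are joined by a chain of circles). The line $L$ divides each plane $P_i$ into two half-planes, and so the circles of $P_i$ into two classes of half-circles, labelled $+$ and $-$. A choice $\sigma\in\{+,-\}^n$ of one class in each plane gives a graph with vertex set $V$ whose edges are all half-circles of the chosen classes; these $2^n$ graphs are the \emph{$s$-frames}. A \emph{spanning complex} of the $c$-frame is a cell complex in $\mathbb{R}^{n+1}$ with exactly one cell $e(J,\sigma,C)$ for every $J\subseteq\{1,\dots,n\}$, every $\sigma\in\{+,-\}^J$ and every connected component $C$ of the graph formed by the half-circles of the classes $(i,\sigma_i)$, $i\in J$, such that: $e(J,\sigma,C)$ is homeomorphic to the cube of dimension $|J|$, with the union of the cells $e(J',\sigma|_{J'},C')$, $J'\subsetneq J$, $C'\subset C$, corresponding to the boundary of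 the cube; any two cells meet exactly in the union of their common faces (which may be empty); the cells with $J=\varnothing$ are the nodes and the cells with $|J|=1$ are the half-circles. The \emph{surface of the $s$-frame} of $\sigma\in\{+,-\}^n$ is the union of the cells $e(J,\sigma|_J,C)$, and the \emph{surface of the $c$-frame} is the union of the surfaces of its $2^n$ $s$-frames. \textbf{Lemma.} For every $c$-frame in $\mathbb{R}^{n+1}$ and every spanning complex of it, the surface of the $c$-frame is the union of all the cells of the complex, and it is an $n$-dimensional closed orientable cellular manifold. That is: (1) the surface is compact and connected, and every point of it has a neighbourhood in it homeomorphic to an open subset of $\mathbb{R}^n$; (2) every cell has dimension at most $n$ and is a face of an $n$-cell, any two $n$-cells are joined by a chain of $n$-cells in which consecutive ones have an $(n-1)$-dimensional face in common, and every $(n-1)$-cell is a face of exactly two $n$-cells; (3) the complex is orientable. Here a system of incidence numbers assigns a sign $[F:G]=\pm1$ to every cell $F$ and every face $G$ of $F$ of codimension one, so that $[F:H]=-[F:H']$ for the two ends $H\ne H'$ of an edge $F$, and $[F:G][G:H]=-[F:G'][G':H]$ whenever $G\neq G'$ are faces of $F$ of codimension one with a common face $H$ of codimension one in both. Such systems exist,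 and for each of them there are signs $\varepsilon(F)=\pm1$ of the $n$-cells with $\varepsilon(F)[F:G]=-\varepsilon(F')[F':G]$ for any two $n$-cells $F\ne F'$ with a common $(n-1)$-dimensional face $G$. -/

import Mathlib

/-- The Euclidean space `ℝⁿ⁺¹`. -/
abbrev Space (n : ℕ) : Type := EuclideanSpace ℝ (Fin (n + 1))

/-- The plane through the point `o` spanned by the vectors `d` and `u`. -/
noncomputable def planeThrough {n : ℕ} (o d u : Space n) : AffineSubspace ℝ (Space n) :=
  AffineSubspace.mk' o (Submodule.span ℝ {d, u})

/-- The circle that lies in the plane `P` and has the segment from `v` to `w` as a diameter. -/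
def circleOn {n : ℕ} (P : AffineSubspace ℝ (Space n)) (v w : Space n) : Set (Space n) :=
  {x | x ∈ P ∧ dist x (midpoint ℝ v w) = dist v w / 2}

/-- A `c`-frame in `ℝⁿ⁺¹`: finitely many nodes on one line `origin + ℝ dir`, and a connected bundle
of circles lying in `n` pairwise non-parallel planes through that line. Every node lies on exactly
one circle of each plane; this circle passes through exactly one other node, the opposite one.
The circle of the `i`-th plane through the node `v` is the one with diameter from `v` to `opp i v`.
Different circles meet in nodes only. -/
structure CFrame (n : ℕ) where
  /-- a point of the line -/
  origin : Space n
  /-- the direction of the line -/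
  dir : Space n
  /-- the `i`-th plane is spanned by `dir` and `side i` -/
  side : Fin n → Space n
  linearIndependent : ∀ i, LinearIndependent ℝ ![dir, side i]
  not_parallel : ∀ i j, i ≠ j →
    ¬ (planeThrough origin dir (side i)).Parallel (planeThrough origin dir (side j))
  /-- the nodes -/
  nodes : Finset (Space n)
  nodes_nonempty : nodes.Nonempty
  nodes_on_line : ∀ v ∈ nodes, ∃ a : ℝ, v = origin + a • dir
  /-- the other node on the circle of the `i`-th plane through a given node -/
  opp : Fin n → nodes → nodes
  opp_opp : ∀ i v, opp i (opp i v) = v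
  opp_ne : ∀ i v, opp i v ≠ v
  circles_meet : ∀ (i j : Fin n) (v w : nodes),
    circleOn (planeThrough origin dir (side i)) v (opp i v) ≠
      circleOn (planeThrough origin dir (side j)) w (opp j w) →
    circleOn (planeThrough origin dir (side i)) v (opp i v) ∩
      circleOn (planeThrough origin dir (side j)) w (opp j w) ⊆ nodes
  connected : ∀ v w : nodes, Relation.ReflTransGen (fun a b => ∃ i, opp i a = b) v w

namespace CFrame

variable {n : ℕ} (K : CFrame n)

/-- The `i`-th plane. -/
noncomputable def plane (i : Fin n) : AffineSubspace ℝ (Space n) := planeThrough K.origin K.dir (K.side i)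

/-- The circle of the `i`-th plane through the node `v`. -/
def circle (i : Fin n) (v : K.nodes) : Set (Space n) := circleOn (K.plane i) v (K.opp i v)

/-- The two closed half-planes (`s = 1` and `s = -1`) into which the line of nodes divides the
`i`-th plane. -/
def halfPlane (i : Fin n) (s : SignType) : Set (Space n) :=
  {x | ∃ a b : ℝ, 0 ≤ b ∧ x = K.origin + a • K.dir + ((s : ℝ) * b) • K.side i}

/-- The half-circle, on the side `s`, of the circle of the `i`-th plane through the node `v`. -/
def halfCircle (i : Fin n) (s : SignType) (v : K.nodes) : Set (Space n) :=
  K.circle i v ∩ K.halfPlane i s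

/-- The nodes that can be reached from `v` along circles of the planes in `J`. -/
def component (J : Set (Fin n)) (v : K.nodes) : Set K.nodes :=
  {w | Relation.ReflTransGen (fun a b => ∃ i ∈ J, K.opp i a = b) v w}

/-- The (indices of the) cells of the surface. A cell is spanned on a connected component `comp` of
the graph of half-circles of some set of classes: one class of half-circles, of sign `sgn i`, in
each plane `i` with `sgn i ≠ 0`, and none in the planes with `sgn i = 0`. -/
@[ext]
structure Face where
  sgn : Fin n → SignType
  comp : Set K.nodes
  isComponent : ∃ v, comp = K.component {i | sgn i ≠ 0} v

variable {K}

/-- `F` is a face of `G` when the graph that spans `F` is part of the graph that spans `G`. -/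
instance : PartialOrder K.Face where
  le F G := F.comp ⊆ G.comp ∧ ∀ i, F.sgn i ≠ 0 → F.sgn i = G.sgn i
  le_refl F := ⟨subset_rfl, fun _ _ => rfl⟩
  le_trans F G H h₁ h₂ := ⟨h₁.1.trans h₂.1, fun i hi =>
    (h₁.2 i hi).trans (h₂.2 i (by rw [← h₁.2 i hi]; exact hi))⟩
  le_antisymm F G h₁ h₂ := by
    refine Face.ext (funext fun i => ?_) (h₁.1.antisymm h₂.1)
    by_cases hi : F.sgn i = 0
    · by_cases hg : G.sgn i = 0
      · rw [hi, hg]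
      · exact (h₂.2 i hg).symm
    · exact h₁.2 i hi

/-- The dimension of a cell: the number of classes of half-circles that it uses. -/
noncomputable def Face.dim (F : K.Face) : ℕ := Set.ncard {i | F.sgn i ≠ 0}

/-- A choice `σ` of one of the two classes of half-circles in every plane defines an `s`-frame, formed
by all half-circles of the chosen classes; there are `2 ^ n` such choices. The cell `F` belongs to
the `s`-frame of `σ` when it is spanned on half-circles of the chosen classes. -/
def Face.InSFrame (F : K.Face) (σ : Fin n → ℤˣ) : Prop :=
  ∀ i, F.sgn i ≠ 0 → (F.sgn i : ℤ) = (σ i : ℤ)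

end CFrame

/-- The set `c` is homeomorphic to the `k`-dimensional cube `[-1, 1]ᵏ` (the closed unit ball of the
sup norm), in such a way that the boundary of the cube corresponds to `b`. -/
def IsCellWithBoundary {X : Type*} [TopologicalSpace X] (k : ℕ) (c b : Set X) : Prop :=
  ∃ h : Metric.closedBall (0 : Fin k → ℝ) 1 ≃ₜ c,
    (fun x => (h x : X)) '' {x | (x : Fin k → ℝ) ∈ Metric.sphere (0 : Fin k → ℝ) 1} = b

/-- A cell complex in `X` with a poset `ι` of cells: every cell is homeomorphic to a cube, with the
union of its proper faces as boundary, and any two cells meet in the union of their common faces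
(possibly the empty set). -/
structure CellComplex (ι : Type*) [PartialOrder ι] (X : Type*) [TopologicalSpace X] where
  dim : ι → ℕ
  cell : ι → Set X
  isCell : ∀ F, IsCellWithBoundary (dim F) (cell F) (⋃ G, ⋃ _ : G < F, cell G)
  inter : ∀ F G, cell F ∩ cell G = ⋃ H, ⋃ _ : H ≤ F ∧ H ≤ G, cell H

namespace CellComplex

variable {ι X : Type*} [PartialOrder ι] [TopologicalSpace X] (C : CellComplex ι X)

/-- The union of all cells. -/
def support : Set X := ⋃ F, C.cell F

/-- `G` is a face of `F` of codimension one. -/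
def IsFacet (G F : ι) : Prop := G < F ∧ C.dim F = C.dim G + 1

/-- Two `n`-cells are neighbours when they have an `(n-1)`-dimensional face in common. -/
def Neighbours (n : ℕ) (F F' : ι) : Prop :=
  C.dim F = n ∧ C.dim F' = n ∧ ∃ G, C.IsFacet G F ∧ C.IsFacet G F'

/-- The cell complex is an `n`-dimensional closed cellular manifold: its union is a connected closed
topological `n`-manifold (for the Hausdorff property and the countability of the topology one takes
`X` to be a Euclidean space), it consists of `n`-cells and their faces, any two `n`-cells are joined
by a chain of neighbours, and every `(n-1)`-cell is a face of exactly two `n`-cells, so that there is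
no boundary. -/
structure IsClosedCellularManifold (n : ℕ) : Prop where
  isCompact : IsCompact C.support
  isConnected : IsConnected C.support
  locallyEuclidean : Nonempty (ChartedSpace (EuclideanSpace ℝ (Fin n)) C.support)
  dim_le : ∀ F, C.dim F ≤ n
  pure : ∀ F, ∃ F', F ≤ F' ∧ C.dim F' = n
  chain : ∀ F F', C.dim F = n → C.dim F' = n → Relation.ReflTransGen (C.Neighbours n) F F'
  two_cells : ∀ G, C.dim G + 1 = n → Set.ncard {F | C.IsFacet G F} = 2

/-- Incidence numbers of the cell complex: `inc F G = 1` or `-1` is the orientation that the oriented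
cell `F` induces on its facet `G`, relative to the chosen orientation of `G`. The two ends of an edge
get opposite signs, and the common face `H` of two facets `G ≠ G'` of a cell `F` gets opposite
orientations from these facets when they are oriented as parts of the boundary of `F`. For a finite complex of
this kind such a system is unique up to a change of orientation of the cells. -/
structure IsIncidence (inc : ι → ι → ℤˣ) : Prop where
  edge : ∀ F H H', C.dim F = 1 → C.IsFacet H F → C.IsFacet H' F → H ≠ H' →
    inc F H = - inc F H'
  diamond : ∀ F G G' H, C.IsFacet G F → C.IsFacet G' F → C.IsFacet H G → C.IsFacet H G' → G ≠ G' →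
    inc F G * inc G H = - (inc F G' * inc G' H)

/-- The `n`-dimensional cell complex is orientable: the cells have incidence numbers, and however
these are chosen, the `n`-cells can be given signs `ε` such that any two `n`-cells with a common
`(n-1)`-dimensional face induce opposite orientations on that face. -/
def IsOrientable (n : ℕ) : Prop :=
  (∃ inc, C.IsIncidence inc) ∧
  ∀ inc, C.IsIncidence inc → ∃ ε : ι → ℤˣ,
    ∀ F F' G, C.dim F = n → C.dim F' = n → C.IsFacet G F → C.IsFacet G F' → F ≠ F' →
      ε F * inc F G = - (ε F' * inc F' G)

end CellComplex

namespace CFrame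

variable {n : ℕ}

/-- A cell complex in `ℝⁿ⁺¹` spanned on the `c`-frame `K`: its vertices are the nodes, its edges are
the half-circles, and, inductively, every connected graph formed by `k` classes of half-circles from
`k` different planes spans one `k`-cell, whose boundary consists of the cells spanned on its
subgraphs. In particular each `s`-frame spans one `n`-cell, and `s`-frames share the cells that are
spanned on their common subgraphs. -/
structure SpanningComplex (K : CFrame n) extends CellComplex K.Face (Space n) where
  dim_eq : ∀ F, dim F = F.dim
  vertex : ∀ F : K.Face, (∀ i, F.sgn i = 0) → ∀ v ∈ F.comp, cell F = {(v : Space n)}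
  edge : ∀ (F : K.Face) (i : Fin n), (∀ j, F.sgn j ≠ 0 ↔ j = i) →
    ∀ v ∈ F.comp, cell F = K.halfCircle i (F.sgn i) v

/-- The surface of the `s`-frame of the choice `σ`. -/
def SpanningComplex.sSurface {K : CFrame n} (S : K.SpanningComplex) (σ : Fin n → ℤˣ) :
    Set (Space n) :=
  ⋃ F, ⋃ _ : Face.InSFrame F σ, S.cell F

/-- The surface of the `c`-frame: the union of the surfaces of its `s`-frames. -/
def SpanningComplex.surface {K : CFrame n} (S : K.SpanningComplex) : Set (Space n) :=
  ⋃ σ, S.sSurface σ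

end CFrame

/-! The signs of a cell fix a graph, and any node of the cell picks out the component, so signs and
one node determine the cell. Hence the cells containing a cell F correspond, order included, to the
sign vectors on the set Z of planes that F does not use, that is, to the faces of the orthants of
ℝ^Z. The combinatorics follows: an (n-1)-cell leaves one plane free and has two cofacets; the
n-cells are the full sign vectors, as the bundle is connected, and one passes between them by
changing one sign at a time.

The same correspondence gives charts. Let B be the interior of F. A map from B × ℝ^Z to the support
is built by induction over the cells above F: the closed orthant of s ≠ 0 is its boundary times [0,
∞) along its diagonal, the cell of s contains an open collar of its own boundary, and the map
already defined over the boundary is extended along the collar. The pieces are open embeddings into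
the cells and glue (`chart_openEmbOn_cell`, `exists_isOpenEmbedding`); finally dim F + |Z| = n.

For orientability one system of incidence numbers is written down: the alternating signs of a cube,
and at the vertices a 2-colouring of the nodes in which opposite nodes differ. Here the geometry of
the circles enters: circles of one plane do not cross, so the nodes between two opposite ones are
paired off and the position on the line changes parity (`exists_coloring`). For this system the
product of the signs of an n-cell orients the complex. Any other system differs from it by a
cocycle, which is a coboundary because the facets of a cell are linked through faces of codimension
two (`exists_sign_of_cocycle`). -/

/-! ### Open embeddings between subspaces -/

open Set Topology in
/-- `f` restricts to an open embedding of the subspace `s` into the subspace `t`. -/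
structure OpenEmbOn {A B : Type*} [TopologicalSpace A] [TopologicalSpace B] (f : A → B) (s : Set A)
    (t : Set B) : Prop where
  mapsTo : MapsTo f s t
  continuousOn : ContinuousOn f s
  injOn : InjOn f s
  isOpen_image : ∀ U, IsOpen U → ∃ W, IsOpen W ∧ f '' (U ∩ s) = W ∩ t

namespace OpenEmbOn

open Set Topology

variable {A B D : Type*} [TopologicalSpace A] [TopologicalSpace B] [TopologicalSpace D]

theorem isOpenEmbedding {f : A → B} {s : Set A} {t : Set B} (h : OpenEmbOn f s t) :
    IsOpenEmbedding (h.mapsTo.restrict f s t) := by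
  refine .of_continuous_injective_isOpenMap (h.continuousOn.mapsToRestrict h.mapsTo)
    ((MapsTo.restrict_inj h.mapsTo).2 h.injOn) ?_
  rintro _ ⟨U, hU, rfl⟩
  obtain ⟨W, hW, e⟩ := h.isOpen_image U hU
  refine ⟨W, hW, ?_⟩
  ext ⟨y, hy⟩
  have : y ∈ f '' (U ∩ s) ↔ y ∈ W ∩ t := by rw [e]
  constructor
  · intro hyW
    obtain ⟨x, ⟨hx, hxs⟩, hxy⟩ := this.2 ⟨hyW, hy⟩
    exact ⟨⟨x, hxs⟩, hx, Subtype.ext hxy⟩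
  · rintro ⟨⟨x, hxs⟩, hx, hxy⟩
    exact (this.1 ⟨x, ⟨hx, hxs⟩, congrArg Subtype.val hxy⟩).1

theorem of_isOpenEmbedding {f : A → B} {s : Set A} {t : Set B} (h : MapsTo f s t)
    (ho : IsOpenEmbedding (h.restrict f s t)) : OpenEmbOn f s t where
  mapsTo := h
  continuousOn := by
    rw [continuousOn_iff_continuous_domRestrict]
    exact continuous_subtype_val.comp ho.continuous
  injOn := (MapsTo.restrict_inj h).1 ho.injective
  isOpen_image U hU := by
    obtain ⟨W, hW, e⟩ := ho.isOpenMap _ (hU.preimage continuous_subtype_val)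
    refine ⟨W, hW, ?_⟩
    ext y
    constructor
    · rintro ⟨x, ⟨hx, hxs⟩, rfl⟩
      have : (⟨f x, h hxs⟩ : t) ∈ Subtype.val ⁻¹' W := by
        rw [e]; exact ⟨⟨x, hxs⟩, hx, rfl⟩
      exact ⟨this, h hxs⟩
    · rintro ⟨hy, hyt⟩
      have : (⟨y, hyt⟩ : t) ∈ Subtype.val ⁻¹' W := hy
      rw [e] at this
      obtain ⟨⟨x, hxs⟩, hx, hxy⟩ := this
      exact ⟨x, ⟨hx, hxs⟩, congrArg Subtype.val hxy⟩

theorem comp {f : A → B} {g : B → D} {s : Set A} {t : Set B} {r : Set D} (hg : OpenEmbOn g t r)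
    (hf : OpenEmbOn f s t) : OpenEmbOn (g ∘ f) s r :=
  of_isOpenEmbedding (hg.mapsTo.comp hf.mapsTo) (hg.isOpenEmbedding.comp hf.isOpenEmbedding)

theorem congr {f g : A → B} {s : Set A} {t : Set B} (hf : OpenEmbOn f s t) (h : EqOn f g s) :
    OpenEmbOn g s t where
  mapsTo := hf.mapsTo.congr h
  continuousOn := hf.continuousOn.congr h.symm
  injOn := hf.injOn.congr h
  isOpen_image U hU := by
    rw [← (h.mono inter_subset_right).image_eq]
    exact hf.isOpen_image U hU

theorem prodMap_id {f : A → B} {s : Set A} {t : Set B} (hf : OpenEmbOn f s t) (r : Set D) :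
    OpenEmbOn (Prod.map f id) (s ×ˢ r) (t ×ˢ r) :=
  of_isOpenEmbedding (fun _ hp => ⟨hf.mapsTo hp.1, hp.2⟩)
    ((Homeomorph.Set.prod t r).symm.isOpenEmbedding.comp
      ((hf.isOpenEmbedding.prodMap .id).comp (Homeomorph.Set.prod s r).isOpenEmbedding))

/-- Here `f` is a homeomorphism of `s` onto `t'`, a relatively open part of `t`; continuity of the
inverse makes images open. -/
theorem of_leftInverse {f : A → B} {g : B → A} {s : Set A} {t t' W : Set B}
    (hW : IsOpen W) (ht' : t' = W ∩ t) (hf : ContinuousOn f s) (hg : ContinuousOn g t')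
    (hm : MapsTo f s t') (hm' : MapsTo g t' s) (h : LeftInvOn g f s) (h' : LeftInvOn f g t') :
    OpenEmbOn f s t where
  mapsTo x hx := by have := hm hx; rw [ht'] at this; exact this.2
  continuousOn := hf
  injOn := h.injOn
  isOpen_image U hU := by
    obtain ⟨V, hV, e⟩ := continuousOn_iff'.1 hg U hU
    refine ⟨V ∩ W, hV.inter hW, ?_⟩
    rw [inter_assoc, ← ht', ← e]
    ext y
    constructor
    · rintro ⟨x, ⟨hx, hxs⟩, rfl⟩
      exact ⟨by rwa [mem_preimage, h hxs], hm hxs⟩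
    · rintro ⟨hy, hyt⟩
      exact ⟨g y, ⟨hy, hm' hyt⟩, h' hyt⟩

/-- By `hst` the pieces are full preimages, so compatibility of the pieces is automatic. The image
of an open set misses only the closed union of the parts missed in the single pieces. -/
theorem iUnion {κ : Type*} [Finite κ] {f : A → B} {s : κ → Set A} {t : κ → Set B}
    (h : ∀ i, OpenEmbOn f (s i) (t i)) (hs : ∀ i, IsClosed (s i)) (ht : ∀ i, IsClosed (t i))
    (hst : ∀ i, ∀ x ∈ ⋃ j, s j, f x ∈ t i → x ∈ s i) : OpenEmbOn f (⋃ i, s i) (⋃ i, t i) where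
  mapsTo x hx := by
    obtain ⟨i, hi⟩ := mem_iUnion.1 hx
    exact mem_iUnion.2 ⟨i, (h i).mapsTo hi⟩
  continuousOn := (locallyFinite_of_finite s).continuousOn_iUnion hs fun i => (h i).continuousOn
  injOn x hx y hy hxy := by
    obtain ⟨i, hi⟩ := mem_iUnion.1 hx
    exact (h i).injOn hi (hst i y hy (hxy ▸ (h i).mapsTo hi)) hxy
  isOpen_image U hU := by
    choose W hW e using fun i => (h i).isOpen_image U hU
    refine ⟨(⋃ i, t i ∩ (W i)ᶜ)ᶜ,
      (isClosed_iUnion_of_finite fun i => (ht i).inter (hW i).isClosed_compl).isOpen_compl, ?_⟩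
    ext y
    constructor
    · rintro ⟨x, ⟨hxU, hx⟩, rfl⟩
      refine ⟨fun hc => ?_, ?_⟩
      · obtain ⟨i, hi, hi'⟩ := mem_iUnion.1 hc
        have : f x ∈ W i ∩ t i := by rw [← e i]; exact ⟨x, ⟨hxU, hst i x hx hi⟩, rfl⟩
        exact hi' this.1
      · obtain ⟨i, hi⟩ := mem_iUnion.1 hx
        exact mem_iUnion.2 ⟨i, (h i).mapsTo hi⟩
    · rintro ⟨hc, hy⟩
      obtain ⟨i, hi⟩ := mem_iUnion.1 hy
      have hyW : y ∈ W i := by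
        by_contra hn
        exact hc (mem_iUnion.2 ⟨i, hi, hn⟩)
      have : y ∈ f '' (U ∩ s i) := by rw [e i]; exact ⟨hyW, hi⟩
      obtain ⟨x, ⟨hxU, hx⟩, rfl⟩ := this
      exact ⟨x, ⟨hxU, mem_iUnion.2 ⟨i, hx⟩⟩, rfl⟩

end OpenEmbOn

/-! ### Interior and collar of a cell -/

namespace IsCellWithBoundary

open Set Topology Metric

variable {X : Type*} [TopologicalSpace X] {k : ℕ} {c b : Set X}

/-- A parametrization of a cell by the cube, as a map of the ambient spaces. -/
theorem exists_param (H : IsCellWithBoundary k c b) :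
    ∃ (v : (Fin k → ℝ) → X) (u : X → Fin k → ℝ),
      ContinuousOn v (closedBall 0 1) ∧ ContinuousOn u c ∧ MapsTo v (closedBall 0 1) c ∧
      MapsTo u c (closedBall 0 1) ∧ LeftInvOn u v (closedBall 0 1) ∧ LeftInvOn v u c ∧
      v '' sphere 0 1 = b := by
  classical
  obtain ⟨h, hb⟩ := H
  let v : (Fin k → ℝ) → X := fun x => if hx : x ∈ closedBall 0 1 then h ⟨x, hx⟩
    else h ⟨0, mem_closedBall_self zero_le_one⟩
  let u : X → (Fin k → ℝ) := fun x => if hx : x ∈ c then h.symm ⟨x, hx⟩ else 0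
  have hv : ∀ x (hx : x ∈ closedBall 0 1), v x = h ⟨x, hx⟩ := fun x hx => dif_pos hx
  have hu : ∀ x (hx : x ∈ c), u x = h.symm ⟨x, hx⟩ := fun x hx => dif_pos hx
  refine ⟨v, u, ?_, ?_, ?_, ?_, ?_, ?_, ?_⟩
  · rw [continuousOn_iff_continuous_domRestrict]
    exact (continuous_subtype_val.comp h.continuous).congr fun x => (hv x x.2).symm
  · rw [continuousOn_iff_continuous_domRestrict]
    exact (continuous_subtype_val.comp h.symm.continuous).congr fun x => (hu x x.2).symm
  · intro x hx
    rw [hv x hx]; exact Subtype.coe_prop _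
  · intro x hx
    rw [hu x hx]; exact Subtype.coe_prop _
  · intro x hx
    rw [hv x hx, hu _ (Subtype.coe_prop _)]
    simp
  · intro x hx
    rw [hu x hx, hv _ (Subtype.coe_prop _)]
    simp
  · rw [← hb]
    ext y
    constructor
    · rintro ⟨x, hx, rfl⟩
      exact ⟨⟨x, sphere_subset_closedBall hx⟩, hx, (hv x _).symm⟩
    · rintro ⟨x, hx, rfl⟩
      exact ⟨x, hx, hv x x.2⟩

theorem subset (H : IsCellWithBoundary k c b) : b ⊆ c := by
  obtain ⟨v, u, -, -, hv, -, -, -, rfl⟩ := H.exists_param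
  exact (hv.mono_left sphere_subset_closedBall).image_subset

theorem isCompact (H : IsCellWithBoundary k c b) : IsCompact c := by
  obtain ⟨v, u, hv, -, hm, hm', -, h, -⟩ := H.exists_param
  have : c = v '' closedBall 0 1 :=
    Subset.antisymm (fun x hx => ⟨u x, hm' hx, h hx⟩) hm.image_subset
  rw [this]
  exact (isCompact_closedBall _ _).image_of_continuousOn hv

theorem isConnected (H : IsCellWithBoundary k c b) : IsConnected c := by
  obtain ⟨v, u, hv, -, hm, hm', -, h, -⟩ := H.exists_param
  have : c = v '' closedBall 0 1 :=
    Subset.antisymm (fun x hx => ⟨u x, hm' hx, h hx⟩) hm.image_subset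
  rw [this]
  exact ((convex_closedBall _ _).isConnected ⟨0, mem_closedBall_self zero_le_one⟩).image _ hv

/-- The interior of a cell is parametrized by the open cube. -/
theorem exists_interior_param (H : IsCellWithBoundary k c b) :
    ∃ v : (Fin k → ℝ) → X, OpenEmbOn v (ball 0 1) c ∧ v '' ball 0 1 = c \ b := by
  obtain ⟨v, u, hv, hu, hm, hm', h, h', hb⟩ := H.exists_param
  have hS : ∀ x ∈ closedBall (0 : Fin k → ℝ) 1, v x ∈ b ↔ x ∈ sphere 0 1 := by
    intro x hx
    rw [← hb]
    refine ⟨?_, fun hx => ⟨x, hx, rfl⟩⟩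
    rintro ⟨y, hy, e⟩
    rwa [← h.injOn (sphere_subset_closedBall hy) hx e]
  have hi : v '' ball 0 1 = c \ b := by
    ext y
    constructor
    · rintro ⟨x, hx, rfl⟩
      refine ⟨hm (ball_subset_closedBall hx), fun hc => ?_⟩
      have := (hS x (ball_subset_closedBall hx)).1 hc
      rw [mem_sphere] at this
      rw [mem_ball] at hx
      exact hx.ne this
    · rintro ⟨hy, hyb⟩
      refine ⟨u y, ?_, h' hy⟩
      rw [mem_ball]
      refine lt_of_le_of_ne (mem_closedBall.1 (hm' hy)) fun e => hyb ?_
      rw [← h' hy]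
      exact (hS _ (hm' hy)).2 e
  obtain ⟨W, hW, e⟩ := continuousOn_iff'.1 hu _ (isOpen_ball (x := (0 : Fin k → ℝ)) (ε := 1))
  have hi' : c \ b = u ⁻¹' ball 0 1 ∩ c := by
    rw [← hi]
    ext y
    constructor
    · rintro ⟨x, hx, rfl⟩
      refine ⟨?_, hm (ball_subset_closedBall hx)⟩
      rwa [mem_preimage, h (ball_subset_closedBall hx)]
    · rintro ⟨hy, hyc⟩
      exact ⟨u y, hy, h' hyc⟩
  refine ⟨v, ?_, hi⟩
  refine OpenEmbOn.of_leftInverse (g := u) (t' := c \ b) hW (hi'.trans e)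
    (hv.mono ball_subset_closedBall) (hu.mono sdiff_subset) ?_ ?_
    (h.mono ball_subset_closedBall) (h'.mono sdiff_subset)
  · intro x hx
    rw [← hi]; exact ⟨x, hx, rfl⟩
  · intro x hx
    rw [hi'] at hx; exact hx.1

/-- The boundary of a cell has an open collar in the cell. -/
theorem exists_collar (H : IsCellWithBoundary k c b) :
    ∃ γ : X × ℝ → X, (∀ z ∈ b, γ (z, 0) = z) ∧ OpenEmbOn γ (b ×ˢ Ici 0) c := by
  obtain ⟨v, u, hv, hu, hm, hm', h, h', hb⟩ := H.exists_param
  have hbc := H.subset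
  have hub : MapsTo u b (sphere 0 1) := by
    rw [← hb]
    rintro _ ⟨x, hx, rfl⟩
    rwa [h (sphere_subset_closedBall hx)]
  -- The collar is radial: (z, t) goes to the point z/(1 + t) of the cube, which sweeps out the cube
  -- minus its centre. The inverse normalizes x and takes t = 1/‖x‖ - 1.
  have hsc : MapsTo (fun p : X × ℝ => (1 + p.2)⁻¹ • u p.1) (b ×ˢ Ici 0)
      (closedBall (0 : Fin k → ℝ) 1 ∩ {x | x ≠ 0}) := by
    rintro ⟨z, t⟩ ⟨hz, ht⟩
    have hz' : ‖u z‖ = 1 := by simpa using hub hz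
    have ht' : 0 ≤ t := ht
    refine ⟨?_, ?_⟩
    · rw [mem_closedBall_zero_iff, norm_smul, hz', mul_one, Real.norm_eq_abs,
        abs_of_nonneg (by positivity)]
      exact inv_le_one_of_one_le₀ (by linarith)
    · refine smul_ne_zero (by positivity) ?_
      rw [← norm_ne_zero_iff, hz']
      exact one_ne_zero
  have hcont : ContinuousOn (fun p : X × ℝ => (1 + p.2)⁻¹ • u p.1) (b ×ˢ Ici 0) := by
    have h1 : ContinuousOn (fun p : X × ℝ => u p.1) (b ×ˢ Ici 0) :=
      (hu.mono hbc).comp continuousOn_fst fun p hp => hp.1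
    have h2 : ContinuousOn (fun p : X × ℝ => 1 + p.2) (b ×ˢ Ici 0) := by fun_prop
    refine ContinuousOn.smul (h2.inv₀ ?_) h1
    rintro ⟨z, t⟩ ⟨-, ht⟩
    have ht' : 0 ≤ t := ht
    positivity
  obtain ⟨W, hW, e⟩ := continuousOn_iff'.1 hu {x | x ≠ 0} isOpen_ne
  refine ⟨fun p => v ((1 + p.2)⁻¹ • u p.1), fun z hz => ?_, ?_⟩
  · simpa using h' (hbc hz)
  have hnorm : ∀ x : Fin k → ℝ, x ≠ 0 → ‖‖x‖⁻¹ • x‖ = 1 := fun x hx => by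
    rw [norm_smul, norm_inv, norm_norm, inv_mul_cancel₀ (norm_ne_zero_iff.2 hx)]
  have hne : ∀ p ∈ u ⁻¹' {x | x ≠ 0} ∩ c, ‖u p‖ ≠ 0 := fun p hp => norm_ne_zero_iff.2 hp.1
  have hu' : ContinuousOn u (u ⁻¹' {x | x ≠ 0} ∩ c) := hu.mono inter_subset_right
  refine OpenEmbOn.of_leftInverse (g := fun x => (v (‖u x‖⁻¹ • u x), ‖u x‖⁻¹ - 1))
    (t' := u ⁻¹' {x | x ≠ 0} ∩ c) hW e (hv.comp hcont fun p hp => (hsc hp).1) ?_ ?_ ?_ ?_ ?_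
  · refine ContinuousOn.prodMk (hv.comp (ContinuousOn.smul (hu'.norm.inv₀ hne) hu') ?_)
      ((hu'.norm.inv₀ hne).sub continuousOn_const)
    intro x hx
    exact mem_closedBall_zero_iff.2 (hnorm _ hx.1).le
  · intro p hp
    refine ⟨?_, hm (hsc hp).1⟩
    rw [mem_preimage, h (hsc hp).1]
    exact (hsc hp).2
  · intro x hx
    refine ⟨?_, ?_⟩
    · rw [← hb]
      exact ⟨_, mem_sphere_zero_iff_norm.2 (hnorm _ hx.1), rfl⟩
    · have h1 : ‖u x‖ ≤ 1 := mem_closedBall_zero_iff.1 (hm' hx.2)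
      have := one_le_inv₀ (norm_pos_iff.2 hx.1) |>.2 h1
      simpa using this
  · rintro ⟨z, t⟩ ⟨hz, ht⟩
    have ht' : 0 ≤ t := ht
    have hz' : ‖u z‖ = 1 := by simpa using hub hz
    have hpos : (1 + t) ≠ 0 := by positivity
    have hn : ‖(1 + t)⁻¹ • u z‖ = (1 + t)⁻¹ := by
      rw [norm_smul, hz', mul_one, Real.norm_eq_abs, abs_of_nonneg (by positivity)]
    simp only [h (hsc (x := (z, t)) ⟨hz, ht⟩).1, hn, inv_inv, smul_smul,
      mul_inv_cancel₀ hpos, one_smul, h' (hbc hz), add_sub_cancel_left]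
  · intro x hx
    have hx0 : ‖u x‖ ≠ 0 := norm_ne_zero_iff.2 hx.1
    have : u (v (‖u x‖⁻¹ • u x)) = ‖u x‖⁻¹ • u x :=
      h (mem_closedBall_zero_iff.2 (hnorm _ hx.1).le)
    simp only [this, add_sub_cancel, inv_inv, smul_smul, mul_inv_cancel₀ hx0, one_smul, h' hx.2]

end IsCellWithBoundary

/-! ### Orthants as products of boundary and half-line -/

namespace Orthant

open Set

variable {Z : Type*} [Fintype Z]

/-- The vector of signs of a vector. -/
noncomputable def signs (y : Z → ℝ) : Z → SignType := fun i => SignType.sign (y i)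

omit [Fintype Z] in
-- The left side is the face relation of sign vectors, the right side is membership in the closed
-- orthant of `s`.
theorem signs_le_iff {y : Z → ℝ} {s : Z → SignType} :
    (∀ i, signs y i ≠ 0 → signs y i = s i) ↔ ∀ i, 0 ≤ (s i : ℝ) * y i ∧ (s i = 0 → y i = 0) := by
  refine forall_congr' fun i => ?_
  unfold signs
  rcases lt_trichotomy (y i) 0 with h | h | h
  · cases hs : s i <;> simp [h, h.le, h.ne, not_le.2 h]
  · simp [h]
  · cases hs : s i <;> simp [h, h.le, h.ne', not_le.2 h]

theorem mul_self_of_ne_zero {s : SignType} (h : s ≠ 0) : (s : ℝ) * s = 1 := by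
  cases s <;> simp_all

/-- The smallest of the coordinates with non-zero sign of a vector of an orthant. -/
noncomputable def depth (s : Z → SignType) (y : Z → ℝ) : ℝ :=
  if h : (Finset.univ.filter (s · ≠ 0)).Nonempty then
    (Finset.univ.filter (s · ≠ 0)).inf' h fun i => (s i : ℝ) * y i else 0

theorem nonempty_filter {s : Z → SignType} (hs : s ≠ 0) :
    (Finset.univ.filter (s · ≠ 0)).Nonempty := by
  obtain ⟨i, hi⟩ := Function.ne_iff.1 hs
  exact ⟨i, by simpa using hi⟩

theorem depth_le {s : Z → SignType} (y : Z → ℝ) {i : Z} (hi : s i ≠ 0) :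
    depth s y ≤ s i * y i := by
  rw [depth, dif_pos ⟨i, by simpa using hi⟩]
  exact Finset.inf'_le _ (by simpa using hi)

theorem exists_depth_eq {s : Z → SignType} (hs : s ≠ 0) (y : Z → ℝ) :
    ∃ i, s i ≠ 0 ∧ depth s y = s i * y i := by
  rw [depth, dif_pos (nonempty_filter hs)]
  obtain ⟨i, hi, e⟩ := Finset.exists_mem_eq_inf' (nonempty_filter hs) fun i => (s i : ℝ) * y i
  exact ⟨i, by simpa using hi, e⟩

theorem continuous_depth (s : Z → SignType) : Continuous (depth s) := by
  unfold depth
  split_ifs with h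
  · exact Continuous.finset_inf'_apply h fun i _ => by fun_prop
  · exact continuous_const

theorem depth_add {s : Z → SignType} (hs : s ≠ 0) (y : Z → ℝ) (t : ℝ) :
    depth s (y + t • fun i => (s i : ℝ)) = depth s y + t := by
  have key : ∀ i, s i ≠ 0 →
      (s i : ℝ) * (y + t • fun i => (s i : ℝ)) i = s i * y i + t := fun i hi => by
    simp only [Pi.add_apply, Pi.smul_apply, smul_eq_mul]
    linear_combination t * mul_self_of_ne_zero hi
  obtain ⟨i, hi, e⟩ := exists_depth_eq hs y
  obtain ⟨j, hj, e'⟩ := exists_depth_eq hs (y + t • fun i => (s i : ℝ))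
  refine le_antisymm ?_ ?_
  · rw [e, ← key i hi]; exact depth_le _ hi
  · rw [e', key j hj]; exact add_le_add_left (depth_le _ hj) _

theorem depth_nonneg {s : Z → SignType} {y : Z → ℝ}
    (hy : ∀ i, 0 ≤ (s i : ℝ) * y i ∧ (s i = 0 → y i = 0)) : 0 ≤ depth s y := by
  by_cases hs : s = 0
  · simp [depth, hs]
  · obtain ⟨i, -, e⟩ := exists_depth_eq hs y
    rw [e]; exact (hy i).1

/-- Within the closed orthant, leaving the open stratum of `s` means that a coordinate with non-zero
sign vanishes. -/
theorem depth_eq_zero_iff {s : Z → SignType} (hs : s ≠ 0) {y : Z → ℝ}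
    (hy : ∀ i, 0 ≤ (s i : ℝ) * y i ∧ (s i = 0 → y i = 0)) : depth s y = 0 ↔ signs y ≠ s := by
  constructor
  · rintro h rfl
    obtain ⟨i, hi, e⟩ := exists_depth_eq hs y
    rw [h] at e
    rcases mul_eq_zero.1 e.symm with h' | h'
    · exact hi (by generalize signs y i = s at h'; cases s <;> simp_all)
    · exact hi (by simp [signs, h'])
  · intro h
    obtain ⟨i, hi⟩ := Function.ne_iff.1 h
    have h0 : signs y i = 0 := by
      by_contra hc
      exact hi (signs_le_iff.2 hy i hc)
    have h1 : y i = 0 := by simpa [signs] using h0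
    refine le_antisymm ?_ (depth_nonneg hy)
    have := depth_le (s := s) y (i := i) fun h => hi (h0.trans h.symm)
    simpa [h1] using this

/-- The projection of an orthant to its boundary, along the diagonal. -/
noncomputable def proj (s : Z → SignType) (y : Z → ℝ) : Z → ℝ :=
  y + (-depth s y) • fun i => (s i : ℝ)

theorem proj_mem {s : Z → SignType} {y : Z → ℝ}
    (hy : ∀ i, 0 ≤ (s i : ℝ) * y i ∧ (s i = 0 → y i = 0)) (i : Z) :
    0 ≤ (s i : ℝ) * proj s y i ∧ (s i = 0 → proj s y i = 0) := by
  by_cases hi : s i = 0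
  · simp [proj, hi, (hy i).2 hi]
  · refine ⟨?_, fun h => absurd h hi⟩
    have h1 := depth_le y hi
    have : (s i : ℝ) * proj s y i = s i * y i - depth s y := by
      simp only [proj, Pi.add_apply, Pi.smul_apply, smul_eq_mul]
      linear_combination (-depth s y) * mul_self_of_ne_zero hi
    linarith

theorem depth_proj {s : Z → SignType} (hs : s ≠ 0) (y : Z → ℝ) : depth s (proj s y) = 0 := by
  rw [proj, depth_add hs, add_neg_cancel]

theorem signs_proj_ne {s : Z → SignType} (hs : s ≠ 0) {y : Z → ℝ}
    (hy : ∀ i, 0 ≤ (s i : ℝ) * y i ∧ (s i = 0 → y i = 0)) : signs (proj s y) ≠ s :=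
  (depth_eq_zero_iff hs (proj_mem hy)).1 (depth_proj hs y)

omit [Fintype Z] in
theorem signs_self (y : Z → ℝ) (i : Z) :
    0 ≤ (signs y i : ℝ) * y i ∧ (signs y i = 0 → y i = 0) :=
  signs_le_iff.1 (fun _ _ => rfl) i

/-- The projection kills the smallest coordinate and creates no new sign; this makes the recursion
of `chart` terminate. -/
theorem card_signs_proj_lt {y : Z → ℝ} (hy : signs y ≠ 0) :
    (Finset.univ.filter (signs (proj (signs y) y) · ≠ 0)).card <
      (Finset.univ.filter (signs y · ≠ 0)).card := by
  have h1 := signs_le_iff.2 (proj_mem (signs_self y))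
  refine Finset.card_lt_card ⟨fun i hi => ?_, fun h => ?_⟩
  · simp only [Finset.mem_filter, Finset.mem_univ, true_and] at hi ⊢
    rwa [← h1 i hi]
  · refine signs_proj_ne hy (signs_self y) (funext fun i => ?_)
    by_cases hi : signs y i = 0
    · by_cases hi' : signs (proj (signs y) y) i = 0
      · rw [hi, hi']
      · exact h1 i hi'
    · have := h (by simpa using hi : i ∈ Finset.univ.filter (signs y · ≠ 0))
      exact h1 i (by simpa using this)

omit [Fintype Z] in
theorem add_mem {s : Z → SignType} {y : Z → ℝ}
    (hy : ∀ i, 0 ≤ (s i : ℝ) * y i ∧ (s i = 0 → y i = 0)) {t : ℝ} (ht : 0 ≤ t) (i : Z) :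
    0 ≤ (s i : ℝ) * (y + t • fun i => (s i : ℝ)) i ∧
      (s i = 0 → (y + t • fun i => (s i : ℝ)) i = 0) := by
  refine ⟨?_, fun hi => by simp [hi, (hy i).2 hi]⟩
  have : (s i : ℝ) * (y + t • fun i => (s i : ℝ)) i = s i * y i + t * (s i * s i : ℝ) := by
    simp only [Pi.add_apply, Pi.smul_apply, smul_eq_mul]
    ring
  rw [this]
  have h1 := (hy i).1
  have h2 := mul_self_nonneg (s i : ℝ)
  positivity

end Orthant

/-! ### Charts of a cell complex from collars -/

namespace CellComplex

open Set Topology Orthant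

variable {ι X : Type*} [PartialOrder ι] [TopologicalSpace X] (C : CellComplex ι X)

/-- The union of the proper faces of a cell. -/
def boundary (F : ι) : Set X := ⋃ G, ⋃ _ : G < F, C.cell G

variable {C}

theorem cell_subset {F G : ι} (h : F ≤ G) : C.cell F ⊆ C.cell G := by
  have : C.cell F ⊆ C.cell F ∩ C.cell G := by
    rw [C.inter]
    exact subset_iUnion₂_of_subset F ⟨le_rfl, h⟩ subset_rfl
  exact this.trans inter_subset_right

/-- If `x` lies in the interior of `F` and in `G`, a common face contains `x`; it cannot be a proper
face of `F`, so it is `F`. -/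
theorem mem_cell_iff {F G : ι} {x : X} (h : x ∈ C.cell F \ C.boundary F) :
    x ∈ C.cell G ↔ F ≤ G := by
  refine ⟨fun hx => ?_, fun hle => cell_subset hle h.1⟩
  have : x ∈ C.cell F ∩ C.cell G := ⟨h.1, hx⟩
  rw [C.inter] at this
  obtain ⟨H, ⟨hF, hG⟩, hxH⟩ := mem_iUnion₂.1 this
  rcases hF.eq_or_lt with rfl | hlt
  · exact hG
  · exact absurd (mem_iUnion₂.2 ⟨H, hlt, hxH⟩) h.2

theorem exists_mem_interior [Finite ι] {x : X} (hx : x ∈ C.support) :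
    ∃ F, x ∈ C.cell F \ C.boundary F := by
  have hne : {F | x ∈ C.cell F}.Nonempty := mem_iUnion.1 hx
  have hwf : WellFounded (· < · : ι → ι → Prop) := wellFounded_lt
  refine ⟨hwf.min _ hne, hwf.min_mem _ hne, fun hc => ?_⟩
  obtain ⟨G, hG, hxG⟩ := mem_iUnion₂.1 hc
  exact hwf.not_lt_min _ hxG hG

variable {Z E : Type*} [Fintype Z]

/-- Coordinates near a point of a cell, obtained from a parametrization `base` of the interior of
the cell and from collars `γ` of the boundaries of the larger cells `φ s`, indexed by vectors of
signs. -/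
noncomputable def chart (γ : ι → X × ℝ → X) (φ : (Z → SignType) → ι) (base : E → X) (b : E)
    (y : Z → ℝ) : X :=
  open Classical in
  if signs y = 0 then base b
  else γ (φ (signs y)) (chart γ φ base b (proj (signs y) y), depth (signs y) y)
termination_by (Finset.univ.filter (signs y · ≠ 0)).card
decreasing_by exact card_signs_proj_lt ‹_›

variable {γ : ι → X × ℝ → X} {φ : (Z → SignType) → ι} {base : E → X}

omit [PartialOrder ι] [TopologicalSpace X] in
theorem chart_of_eq_zero (b : E) {y : Z → ℝ} (h : signs y = 0) :
    chart γ φ base b y = base b := by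
  rw [chart, if_pos h]

omit [PartialOrder ι] [TopologicalSpace X] in
theorem chart_of_ne_zero (b : E) {y : Z → ℝ} (h : signs y ≠ 0) :
    chart γ φ base b y =
      γ (φ (signs y)) (chart γ φ base b (proj (signs y) y), depth (signs y) y) := by
  rw [chart, if_neg h]

-- The map φ embeds the poset of sign vectors into the cells above φ 0; later `hup` makes it
-- surjective onto them.
variable (hφ : ∀ s t, φ s ≤ φ t ↔ ∀ i, s i ≠ 0 → s i = t i)
  (hγ₀ : ∀ F, ∀ z ∈ C.boundary F, γ F (z, 0) = z)
  (hγ : ∀ F, OpenEmbOn (γ F) (C.boundary F ×ˢ Ici 0) (C.cell F))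
  (hbase : ∀ b, base b ∈ C.cell (φ 0) \ C.boundary (φ 0))

omit [Fintype Z] in
include hφ in
theorem eq_of_sign_map_eq {s t : Z → SignType} (h : φ s = φ t) : s = t := by
  have h1 := (hφ s t).1 h.le
  have h2 := (hφ t s).1 h.ge
  funext i
  by_cases hs : s i = 0
  · by_cases ht : t i = 0
    · rw [hs, ht]
    · exact (h2 i ht).symm
  · exact h1 i hs

include hγ₀ hγ in
-- A boundary point is its own image at height 0, so by injectivity of the collar no point of height
-- t > 0 is sent there.
theorem collar_mem_interior {F : ι} {z : X} {t : ℝ} (hz : z ∈ C.boundary F) (ht : 0 < t) :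
    γ F (z, t) ∈ C.cell F \ C.boundary F := by
  refine ⟨(hγ F).mapsTo ⟨hz, ht.le⟩, fun hc => ?_⟩
  have := (hγ F).injOn (x₁ := (z, t)) (x₂ := (γ F (z, t), 0)) ⟨hz, mem_Ici.2 ht.le⟩
    ⟨hc, self_mem_Ici⟩ (hγ₀ F _ hc).symm
  exact ht.ne' (congrArg Prod.snd this)

include hφ hγ₀ hγ hbase in
-- Strata go to interiors of the corresponding cells; with `mem_cell_iff` this identifies the
-- preimage of every cell, as the gluing requires.
theorem chart_mem_interior (b : E) (y : Z → ℝ) :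
    chart γ φ base b y ∈ C.cell (φ (signs y)) \ C.boundary (φ (signs y)) := by
  by_cases h : signs y = 0
  · rw [chart_of_eq_zero b h, h]
    exact hbase b
  · have ih := chart_mem_interior b (proj (signs y) y)
    rw [chart_of_ne_zero b h]
    refine collar_mem_interior hγ₀ hγ (mem_iUnion₂.2 ⟨_, ?_, ih.1⟩) ?_
    · refine lt_of_le_of_ne ((hφ _ _).2 (signs_le_iff.2 (proj_mem (signs_self y)))) fun e => ?_
      exact signs_proj_ne h (signs_self y) (eq_of_sign_map_eq hφ e)
    · refine lt_of_le_of_ne (depth_nonneg (signs_self y)) fun e => ?_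
      exact (depth_eq_zero_iff h (signs_self y)).1 e.symm rfl
termination_by (Finset.univ.filter (signs y · ≠ 0)).card
decreasing_by exact card_signs_proj_lt ‹_›

include hφ hγ₀ hγ hbase in
theorem chart_mem_cell_iff (b : E) (y : Z → ℝ) (G : ι) :
    chart γ φ base b y ∈ C.cell G ↔ φ (signs y) ≤ G :=
  mem_cell_iff (chart_mem_interior hφ hγ₀ hγ hbase b y)

omit [Fintype Z] in
include hφ in
theorem chart_domain_eq [TopologicalSpace E] (s : Z → SignType) :
    {p : E × (Z → ℝ) | φ (signs p.2) ≤ φ s} =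
      {p | ∀ i, 0 ≤ (s i : ℝ) * p.2 i ∧ (s i = 0 → p.2 i = 0)} := by
  ext p
  rw [mem_ofPred_eq, hφ, signs_le_iff, mem_ofPred_eq]

omit [Fintype Z] in
include hφ in
theorem isClosed_chart_domain [TopologicalSpace E] (hup : ∀ G, φ 0 ≤ G → ∃ s, φ s = G) (G : ι) :
    IsClosed {p : E × (Z → ℝ) | φ (signs p.2) ≤ G} := by
  by_cases hG : φ 0 ≤ G
  · obtain ⟨s, rfl⟩ := hup G hG
    rw [chart_domain_eq hφ]
    simp only [ofPred_forall, ofPred_and]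
    exact isClosed_iInter fun i => (isClosed_le (by fun_prop) (by fun_prop)).inter
      (isClosed_iInter fun _ => isClosed_eq (by fun_prop) continuous_const)
  · convert isClosed_empty
    refine eq_empty_of_forall_notMem fun p hp => hG (le_trans ?_ hp)
    exact (hφ _ _).2 fun i hi => absurd rfl hi

theorem isClosed_cell [T2Space X] (F : ι) : IsClosed (C.cell F) := (C.isCell F).isCompact.isClosed

include hφ hγ₀ hγ hbase in
theorem chart_openEmbOn_biUnion [T2Space X] [Finite ι] [TopologicalSpace E]
    (hup : ∀ G, φ 0 ≤ G → ∃ s, φ s = G) (D : Set ι)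
    (h : ∀ G ∈ D, φ 0 ≤ G → OpenEmbOn (fun p : E × (Z → ℝ) => chart γ φ base p.1 p.2)
      {p | φ (signs p.2) ≤ G} (C.cell G)) :
    OpenEmbOn (fun p : E × (Z → ℝ) => chart γ φ base p.1 p.2)
      (⋃ G : D, {p | φ (signs p.2) ≤ G}) (⋃ G : D, C.cell G) := by
  refine OpenEmbOn.iUnion (fun G => ?_) (fun G => isClosed_chart_domain hφ hup G)
    (fun G => isClosed_cell _) fun G p _ hp =>
      (chart_mem_cell_iff hφ hγ₀ hγ hbase p.1 p.2 G).1 hp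
  by_cases hG : φ 0 ≤ G
  · exact h G G.2 hG
  · have : {p : E × (Z → ℝ) | φ (signs p.2) ≤ G} = ∅ :=
      eq_empty_of_forall_notMem fun p hp =>
        hG (le_trans ((hφ _ _).2 fun i hi => absurd rfl hi) hp)
    rw [this]
    exact ⟨mapsTo_empty _ _, continuousOn_empty _, injOn_empty _,
      fun U _ => ⟨∅, isOpen_empty, by simp⟩⟩

include hφ hγ₀ hγ hbase in
theorem chart_openEmbOn_cell [T2Space X] [Finite ι] [TopologicalSpace E]
    (hup : ∀ G, φ 0 ≤ G → ∃ s, φ s = G) (hbase' : OpenEmbOn base univ (C.cell (φ 0))) (G : ι) :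
    φ 0 ≤ G → OpenEmbOn (fun p : E × (Z → ℝ) => chart γ φ base p.1 p.2)
      {p | φ (signs p.2) ≤ G} (C.cell G) := by
  induction G using WellFoundedLT.induction with
  | ind G ih =>
  intro hG
  obtain ⟨s, rfl⟩ := hup G hG
  have ih' := chart_openEmbOn_biUnion hφ hγ₀ hγ hbase hup {G | G < φ s} ih
  have hcell : ⋃ G : {G | G < φ s}, C.cell G = C.boundary (φ s) := by
    rw [boundary, iUnion_coe_set]; rfl
  have hdom : ⋃ G : {G | G < φ s}, {p : E × (Z → ℝ) | φ (signs p.2) ≤ G} =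
      {p | φ (signs p.2) < φ s} := by
    ext p
    simp only [mem_iUnion, mem_ofPred_eq]
    exact ⟨fun ⟨G, h⟩ => h.trans_lt G.2, fun h => ⟨⟨_, h⟩, le_rfl⟩⟩
  rw [hcell, hdom] at ih'
  by_cases hs : s = 0
  · subst hs
    have hz : ∀ p ∈ {p : E × (Z → ℝ) | φ (signs p.2) ≤ φ 0}, p.2 = 0 := fun p hp => by
      rw [chart_domain_eq hφ] at hp
      exact funext fun i => (hp i).2 rfl
    have hf : OpenEmbOn (Prod.fst : E × (Z → ℝ) → E) {p | φ (signs p.2) ≤ φ 0} univ := by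
      refine OpenEmbOn.of_leftInverse (g := fun b => (b, 0)) (t' := univ) isOpen_univ
        (univ_inter _).symm continuousOn_fst (by fun_prop) (mapsTo_univ _ _) ?_ ?_ fun _ _ => rfl
      · intro b _
        rw [chart_domain_eq hφ]
        intro i; simp
      · intro p hp
        exact Prod.ext rfl (hz p hp).symm
    refine (hbase'.comp hf).congr fun p hp => ?_
    have h0 : signs p.2 = 0 := by
      rw [hz p hp]; funext i; simp [signs]
    exact (chart_of_eq_zero p.1 h0).symm
  · have hdom' : {p : E × (Z → ℝ) | φ (signs p.2) < φ s} =
        {p | (∀ i, 0 ≤ (s i : ℝ) * p.2 i ∧ (s i = 0 → p.2 i = 0)) ∧ depth s p.2 = 0} := by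
      ext p
      rw [mem_ofPred_eq, lt_iff_le_and_ne, hφ, signs_le_iff, mem_ofPred_eq]
      refine and_congr_right fun h => ?_
      rw [depth_eq_zero_iff hs h]
      exact not_congr ⟨eq_of_sign_map_eq hφ, congrArg φ⟩
    -- The orthant splits as its boundary times [0, ∞) by sliding along the diagonal. Composing this
    -- with the induction hypothesis on the boundary and then with the collar gives the chart.
    have hρ : OpenEmbOn (fun p : E × (Z → ℝ) => ((p.1, proj s p.2), depth s p.2))
        {p | φ (signs p.2) ≤ φ s} ({p | φ (signs p.2) < φ s} ×ˢ Ici 0) := by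
      have hc := continuous_depth s
      rw [chart_domain_eq hφ, hdom']
      refine OpenEmbOn.of_leftInverse (t' := _)
        (g := fun q => (q.1.1, q.1.2 + q.2 • fun i => (s i : ℝ))) isOpen_univ
        (univ_inter _).symm ?_ (by fun_prop) ?_ ?_ ?_ ?_
      · unfold proj; fun_prop
      · intro p hp
        exact ⟨⟨proj_mem hp, depth_proj hs _⟩, depth_nonneg hp⟩
      · rintro ⟨⟨b, y⟩, t⟩ ⟨⟨hy, -⟩, ht⟩
        exact add_mem hy ht
      · intro p _
        simp [proj]
      · rintro ⟨⟨b, y⟩, t⟩ ⟨⟨hy, h0⟩, ht⟩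
        have h0' : depth s y = 0 := h0
        simp [proj, depth_add hs, h0']
    refine ((hγ (φ s)).comp ((ih'.prodMap_id _).comp hρ)).congr fun p hp => ?_
    simp only [Function.comp_apply, Prod.map_apply, id_eq]
    -- In the open orthant this is the recursive definition of `chart`; on its boundary the collar
    -- is used at height 0, where it is the identity.
    by_cases hps : signs p.2 = s
    · rw [chart_of_ne_zero (y := p.2) p.1 (hps ▸ hs), hps]
    · have hp' := hp
      rw [chart_domain_eq hφ] at hp'
      have h0 := (depth_eq_zero_iff hs hp').2 hps
      have hpr : proj s p.2 = p.2 := by simp [proj, h0]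
      rw [h0, hpr]
      refine hγ₀ _ _ (ih'.mapsTo ?_)
      rw [hdom']
      exact ⟨hp', h0⟩

variable (C) in
/-- A point in the interior of a cell has a neighbourhood that is the product of the interior of
the cell and a vector space, if the larger cells correspond to vectors of signs. -/
theorem exists_isOpenEmbedding [T2Space X] [Finite ι] {φ : (Z → SignType) → ι}
    (hφ : ∀ s t, φ s ≤ φ t ↔ ∀ i, s i ≠ 0 → s i = t i) (hup : ∀ G, φ 0 ≤ G → ∃ s, φ s = G) :
    ∃ e : Metric.ball (0 : Fin (C.dim (φ 0)) → ℝ) 1 × (Z → ℝ) → C.support,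
      IsOpenEmbedding e ∧ ∀ x : C.support, (x : X) ∈ C.cell (φ 0) \ C.boundary (φ 0) →
        x ∈ range e := by
  obtain ⟨v, hv, hvi⟩ := (C.isCell (φ 0)).exists_interior_param
  choose γ hγ₀ hγ using fun F => (C.isCell F).exists_collar
  let base : Metric.ball (0 : Fin (C.dim (φ 0)) → ℝ) 1 → X := fun b => v b
  have hbase : ∀ b, base b ∈ C.cell (φ 0) \ C.boundary (φ 0) := fun b => by
    rw [boundary, ← hvi]; exact ⟨b, b.2, rfl⟩
  have hbase' : OpenEmbOn base univ (C.cell (φ 0)) := by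
    refine hv.comp (OpenEmbOn.of_isOpenEmbedding (fun x _ => x.2) ?_)
    exact (Homeomorph.Set.univ _).isOpenEmbedding
  have h := chart_openEmbOn_biUnion (C := C) hφ hγ₀ hγ hbase hup univ fun G _ hG =>
    chart_openEmbOn_cell hφ hγ₀ hγ hbase hup hbase' G hG
  have h1 : ⋃ G : (univ : Set ι),
      {p : Metric.ball (0 : Fin (C.dim (φ 0)) → ℝ) 1 × (Z → ℝ) | φ (signs p.2) ≤ G} = univ :=
    eq_univ_of_forall fun p => mem_iUnion.2 ⟨⟨φ (signs p.2), trivial⟩, le_rfl⟩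
  have h2 : ⋃ G : (univ : Set ι), C.cell G = C.support := by
    rw [support, iUnion_coe_set]; simp
  rw [h1, h2] at h
  refine ⟨fun p => h.mapsTo.restrict _ _ _ ⟨p, trivial⟩,
    h.isOpenEmbedding.comp (Homeomorph.Set.univ _).symm.isOpenEmbedding, fun x hx => ?_⟩
  rw [boundary, ← hvi] at hx
  obtain ⟨b, hb, e⟩ := hx
  refine ⟨(⟨b, hb⟩, 0), Subtype.ext ?_⟩
  refine (chart_of_eq_zero _ ?_).trans e
  funext i; simp [signs]

theorem nonempty_chartedSpace_of_forall {H M : Type*} [TopologicalSpace H]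
    [TopologicalSpace M] (h : ∀ x : M, ∃ φ : OpenPartialHomeomorph M H, x ∈ φ.source) :
    Nonempty (ChartedSpace H M) := by
  choose φ hφ using h
  exact ⟨{ atlas := range φ, chartAt := φ, mem_chart_source := hφ,
           chart_mem_atlas := fun x => mem_range_self x }⟩

theorem exists_openPartialHomeomorph {M : Type*} [TopologicalSpace M] {k n : ℕ}
    (hk : k + Fintype.card Z = n) {e : Metric.ball (0 : Fin k → ℝ) 1 × (Z → ℝ) → M}
    (he : IsOpenEmbedding e) {x : M} (hx : x ∈ range e) :
    ∃ φ : OpenPartialHomeomorph M (EuclideanSpace ℝ (Fin n)), x ∈ φ.source := by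
  have hfin : Module.finrank ℝ ((Fin k → ℝ) × (Z → ℝ)) =
      Module.finrank ℝ (EuclideanSpace ℝ (Fin n)) := by
    simp [hk]
  let L := (ContinuousLinearEquiv.ofFinrankEq hfin).toHomeomorph
  have hj : IsOpenEmbedding
      (fun p : Metric.ball (0 : Fin k → ℝ) 1 × (Z → ℝ) => L (p.1, p.2)) :=
    L.isOpenEmbedding.comp (Metric.isOpen_ball.isOpenEmbedding_subtypeVal.prodMap .id)
  have : Nonempty (Metric.ball (0 : Fin k → ℝ) 1 × (Z → ℝ)) := ⟨hx.choose⟩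
  refine ⟨he.toOpenPartialHomeomorph.symm.trans hj.toOpenPartialHomeomorph, ?_⟩
  simpa using hx

end CellComplex

/-! ### Combinatorics of the cells -/

namespace CFrame

variable {n : ℕ} {K : CFrame n}

theorem mem_component_self (J : Set (Fin n)) (v : K.nodes) : v ∈ K.component J v :=
  Relation.ReflTransGen.refl

theorem opp_mem_component {J : Set (Fin n)} {i : Fin n} (hi : i ∈ J) (v : K.nodes) :
    K.opp i v ∈ K.component J v :=
  .single ⟨i, hi, rfl⟩

theorem component_mono {J J' : Set (Fin n)} (h : J ⊆ J') (v : K.nodes) :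
    K.component J v ⊆ K.component J' v := fun _ hw =>
  Relation.ReflTransGen.mono (fun _ _ ⟨i, hi, e⟩ => ⟨i, h hi, e⟩) _ _ hw

theorem component_eq_of_mem {J : Set (Fin n)} {v w : K.nodes} (h : w ∈ K.component J v) :
    K.component J w = K.component J v := by
  have : Std.Symm fun a b : K.nodes => ∃ i ∈ J, K.opp i a = b :=
    ⟨fun a b ⟨i, hi, e⟩ => ⟨i, hi, by rw [← e, K.opp_opp]⟩⟩
  exact Set.Subset.antisymm (fun x hx => h.trans hx)
    fun x hx => (Relation.ReflTransGen.stdSymm.symm _ _ h).trans hx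

theorem component_eq_univ {J : Set (Fin n)} (hJ : ∀ i, i ∈ J) (v : K.nodes) :
    K.component J v = Set.univ :=
  Set.eq_univ_of_forall fun w =>
    Relation.ReflTransGen.mono (fun _ _ ⟨i, e⟩ => ⟨i, hJ i, e⟩) _ _ (K.connected v w)

/-- The cell that is spanned on half-circles of given signs and contains a given node. -/
def face (s : Fin n → SignType) (v : K.nodes) : K.Face :=
  ⟨s, K.component {i | s i ≠ 0} v, v, rfl⟩

namespace Face

instance : Finite K.Face :=
  Finite.of_injective (fun F : K.Face => (F.sgn, F.comp)) fun _ _ h =>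
    Face.ext (congrArg Prod.fst h) (congrArg Prod.snd h)

theorem mem_face (s : Fin n → SignType) (v : K.nodes) : v ∈ (face s v).comp :=
  mem_component_self _ _

theorem comp_eq_component (F : K.Face) {v : K.nodes} (hv : v ∈ F.comp) :
    F.comp = K.component {i | F.sgn i ≠ 0} v := by
  obtain ⟨w, hw⟩ := F.isComponent
  rw [hw] at hv ⊢
  exact (component_eq_of_mem hv).symm

theorem eq_face (F : K.Face) {v : K.nodes} (hv : v ∈ F.comp) : F = face F.sgn v :=
  Face.ext rfl (F.comp_eq_component hv)

theorem exists_mem (F : K.Face) : ∃ v, v ∈ F.comp := by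
  obtain ⟨v, hv⟩ := F.isComponent
  exact ⟨v, hv ▸ mem_component_self _ _⟩

theorem opp_mem (F : K.Face) {v : K.nodes} (hv : v ∈ F.comp) {i : Fin n} (hi : F.sgn i ≠ 0) :
    K.opp i v ∈ F.comp := by
  rw [F.comp_eq_component hv]
  exact opp_mem_component (J := {i | F.sgn i ≠ 0}) hi v

/-- One common node suffices: the component of `F` is generated from it by classes that `G` also
uses. -/
theorem le_iff {F G : K.Face} {v : K.nodes} (hv : v ∈ F.comp) :
    F ≤ G ↔ v ∈ G.comp ∧ ∀ i, F.sgn i ≠ 0 → F.sgn i = G.sgn i := by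
  refine ⟨fun h => ⟨h.1 hv, h.2⟩, fun h => ⟨?_, h.2⟩⟩
  rw [F.comp_eq_component hv, G.comp_eq_component h.1]
  exact component_mono (fun i (hi : F.sgn i ≠ 0) hc => hi ((h.2 i hi).trans hc)) v

theorem face_le_face {s t : Fin n → SignType} (v : K.nodes) :
    face s v ≤ face t v ↔ ∀ i, s i ≠ 0 → s i = t i := by
  rw [le_iff (mem_face s v)]
  exact and_iff_right (mem_face t v)

theorem dim_le (F : K.Face) : F.dim ≤ n := by
  simpa [Face.dim] using Set.ncard_le_card {i | F.sgn i ≠ 0}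

theorem dim_eq_iff {F : K.Face} : F.dim = n ↔ ∀ i, F.sgn i ≠ 0 := by
  constructor
  · intro h i
    have : {i | F.sgn i ≠ 0} = Set.univ := by
      rw [Set.eq_univ_iff_ncard, Nat.card_fin]
      exact h
    exact this.ge trivial
  · intro h
    simp [Face.dim, h]

theorem comp_eq_univ {F : K.Face} (h : ∀ i, F.sgn i ≠ 0) : F.comp = Set.univ := by
  obtain ⟨v, hv⟩ := F.isComponent
  rw [hv]
  exact component_eq_univ h v

theorem dim_eq_zero_iff {F : K.Face} : F.dim = 0 ↔ ∀ i, F.sgn i = 0 := by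
  rw [Face.dim, Set.ncard_eq_zero, Set.eq_empty_iff_forall_notMem]
  simp

/-- A facet is obtained by omission of one class of half-circles. -/
theorem facet_iff {F G : K.Face} {v : K.nodes} (hv : v ∈ G.comp) :
    G < F ∧ F.dim = G.dim + 1 ↔
      v ∈ F.comp ∧ ∃ i, F.sgn i ≠ 0 ∧ G.sgn = Function.update F.sgn i 0 := by
  constructor
  · rintro ⟨hlt, hd⟩
    have hle := hlt.le
    refine ⟨hle.1 hv, ?_⟩
    have hsub : {i | G.sgn i ≠ 0} ⊆ {i | F.sgn i ≠ 0} := fun i hi hc => hi ((hle.2 i hi).trans hc)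
    have h1 : ({i | F.sgn i ≠ 0} \ {i | G.sgn i ≠ 0}).ncard = 1 := by
      rw [Set.ncard_sdiff hsub]
      simp only [Face.dim] at hd
      omega
    obtain ⟨i, hi⟩ := Set.ncard_eq_one.1 h1
    have hi' : i ∈ {i | F.sgn i ≠ 0} \ {i | G.sgn i ≠ 0} := hi ▸ rfl
    refine ⟨i, hi'.1, funext fun j => ?_⟩
    by_cases hj : j = i
    · subst hj
      simpa using hi'.2
    · rw [Function.update_of_ne hj]
      by_cases hG : G.sgn j = 0
      · by_contra hc
        exact hj (hi.le ⟨fun h => hc (hG.trans h.symm), fun h => h hG⟩)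
      · exact hle.2 j hG
  · rintro ⟨hvF, i, hi, e⟩
    have hle : G ≤ F := by
      refine (le_iff hv).2 ⟨hvF, fun j hj => ?_⟩
      rw [e] at hj ⊢
      by_cases hji : j = i
      · subst hji; simp at hj
      · rw [Function.update_of_ne hji]
    have hd : F.dim = G.dim + 1 := by
      have hins : {j | F.sgn j ≠ 0} = insert i {j | G.sgn j ≠ 0} := by
        ext j
        by_cases hji : j = i
        · subst hji; simpa using hi
        · simp [e, hji]
      rw [Face.dim, hins, Set.ncard_insert_of_notMem (by simp [e])]
      rfl
    refine ⟨lt_of_le_of_ne hle ?_, hd⟩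
    rintro rfl
    omega

theorem exists_facet_eq {F G : K.Face} (h : G < F ∧ F.dim = G.dim + 1) :
    ∃ v ∈ G.comp, v ∈ F.comp ∧ ∃ i, F.sgn i ≠ 0 ∧ G = face (Function.update F.sgn i 0) v := by
  obtain ⟨v, hv⟩ := G.exists_mem
  obtain ⟨hF, i, hi, e⟩ := (facet_iff hv).1 h
  exact ⟨v, hv, hF, i, hi, e ▸ G.eq_face hv⟩

theorem facet_face {F : K.Face} {v : K.nodes} (hv : v ∈ F.comp) {i : Fin n} (hi : F.sgn i ≠ 0) :
    face (Function.update F.sgn i 0) v < F ∧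
      F.dim = (face (Function.update F.sgn i 0) v).dim + 1 :=
  (facet_iff (mem_face _ v)).2 ⟨hv, i, hi, rfl⟩

end Face

theorem SpanningComplex.isFacet_iff (S : K.SpanningComplex) {F G : K.Face} :
    S.toCellComplex.IsFacet G F ↔ G < F ∧ F.dim = G.dim + 1 := by
  rw [CellComplex.IsFacet, S.dim_eq, S.dim_eq]

end CFrame

/-! ### Two-colouring of the nodes -/

/-- A fixed-point-free non-crossing involution of a finite set of reals changes the parity of the
position. -/
theorem neg_one_pow_card_eq_neg_of_involution {α : Type*} [Fintype α] {pos : α → ℝ}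
    (hpos : Function.Injective pos) {f : α → α} (hf : ∀ v, f (f v) = v) (hne : ∀ v, f v ≠ v)
    (hcross : ∀ v w, pos v < pos w → pos w < pos (f v) → pos v < pos (f w) ∧ pos (f w) < pos (f v))
    (v : α) :
    (-1 : ℤˣ) ^ (Finset.univ.filter (pos · < pos (f v))).card =
      -(-1) ^ (Finset.univ.filter (pos · < pos v)).card := by
  classical
  wlog hlt : pos v < pos (f v) generalizing v
  · have hlt' : pos (f v) < pos v :=
      lt_of_le_of_ne (not_lt.1 hlt) fun h => hne v (hpos h)
    have := this (f v) (by rwa [hf])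
    rw [hf] at this
    rw [this, neg_neg]
  -- The points strictly between v and f v are permuted by f without fixed points, so their number
  -- vanishes in `ZMod 2`.
  have heven : Even (Finset.univ.filter fun w => pos v < pos w ∧ pos w < pos (f v)).card := by
    rw [← ZMod.natCast_eq_zero_iff_even, Finset.cast_card]
    refine Finset.sum_involution (fun w _ => f w) (fun _ _ => by decide) (fun w _ _ => hne w)
      (fun w hw => ?_) fun w _ => hf w
    simp only [Finset.mem_filter, Finset.mem_univ, true_and] at hw ⊢
    exact hcross v w hw.1 hw.2
  have hcard : (Finset.univ.filter (pos · < pos (f v))).card =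
      (Finset.univ.filter (pos · < pos v)).card +
        ((Finset.univ.filter fun w => pos v < pos w ∧ pos w < pos (f v)).card + 1) := by
    rw [← Finset.card_insert_of_notMem (a := v) (by simp), ← Finset.card_union_of_disjoint]
    · congr 1
      ext w
      simp only [Finset.mem_filter, Finset.mem_univ, true_and, Finset.mem_union, Finset.mem_insert]
      constructor
      · intro h
        rcases lt_trichotomy (pos w) (pos v) with h' | h' | h'
        · exact .inl h'
        · exact .inr (.inl (hpos h'))
        · exact .inr (.inr ⟨h', h⟩)
      · rintro (h | rfl | h)
        · exact h.trans hlt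
        · exact hlt
        · exact h.2
    · rw [Finset.disjoint_left]
      intro w hw hw'
      simp only [Finset.mem_filter, Finset.mem_univ, true_and, Finset.mem_insert] at hw hw'
      rcases hw' with rfl | h
      · exact lt_irrefl _ hw
      · exact hw.not_gt h.1
  rw [hcard, pow_add, pow_succ, heven.neg_one_pow]
  simp

open RealInnerProductSpace in
-- By Pythagoras, with `e` orthogonal to `d`, the left side of the equation is the power of the
-- point with respect to the circle.
theorem mem_circleOn_iff {n : ℕ} {o d u e : Space n} (he : e ∈ Submodule.span ℝ {d, u})
    (hde : ⟪d, e⟫ = 0) (a p q : ℝ) :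
    o + a • d + e ∈ circleOn (planeThrough o d u) (o + p • d) (o + q • d) ↔
      (a - p) * (a - q) * ‖d‖ ^ 2 + ‖e‖ ^ 2 = 0 := by
  have hP : o + a • d + e ∈ planeThrough o d u := by
    rw [planeThrough, AffineSubspace.mem_mk', vsub_eq_sub]
    have : o + a • d + e - o = a • d + e := by abel
    rw [this]
    exact Submodule.add_mem _ (Submodule.smul_mem _ _ (Submodule.subset_span (by simp))) he
  have h1 : o + a • d + e - midpoint ℝ (o + p • d) (o + q • d) = (a - (p + q) / 2) • d + e := by
    rw [midpoint_eq_smul_add, invOf_eq_inv]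
    module
  have h2 : o + p • d - (o + q • d) = (p - q) • d := by module
  have h3 : ‖(a - (p + q) / 2) • d + e‖ ^ 2 = (a - (p + q) / 2) ^ 2 * ‖d‖ ^ 2 + ‖e‖ ^ 2 := by
    rw [norm_add_sq_real, inner_smul_left, hde, norm_smul, mul_pow, Real.norm_eq_abs, sq_abs]
    simp
  have h4 : (‖(p - q) • d‖ / 2) ^ 2 = ((p - q) / 2) ^ 2 * ‖d‖ ^ 2 := by
    rw [norm_smul, div_pow, mul_pow, Real.norm_eq_abs, sq_abs]
    ring
  rw [circleOn, Set.mem_ofPred_eq, and_iff_right hP, dist_eq_norm, dist_eq_norm, h1, h2,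
    ← sq_eq_sq₀ (norm_nonneg _) (by positivity), h3, h4, ← sub_eq_zero]
  refine Eq.congr ?_ rfl
  ring

namespace CFrame

variable {n : ℕ} (K : CFrame n)

open RealInnerProductSpace in
/-- Circles of the same plane do not cross. -/
theorem circles_not_cross (i : Fin n) (v w : K.nodes) {p p' q q' : ℝ}
    (hp : (v : Space n) = K.origin + p • K.dir)
    (hp' : (K.opp i v : Space n) = K.origin + p' • K.dir)
    (hq : (w : Space n) = K.origin + q • K.dir)
    (hq' : (K.opp i w : Space n) = K.origin + q' • K.dir)
    (h : (q - p) * (q - p') < 0) : ¬ 0 < (q' - p) * (q' - p') := by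
  intro h'
  have hli := LinearIndependent.pair_iff.1 (K.linearIndependent i)
  have hd : K.dir ≠ 0 := fun hd => by
    have := hli 1 0 (by simp [hd])
    exact one_ne_zero this.1
  have hd' : ‖K.dir‖ ^ 2 ≠ 0 := pow_ne_zero _ (norm_ne_zero_iff.2 hd)
  set u := K.side i - (⟪K.dir, K.side i⟫ / ‖K.dir‖ ^ 2) • K.dir with hu
  have hu0 : u ≠ 0 := fun h0 => by
    have := hli (-(⟪K.dir, K.side i⟫ / ‖K.dir‖ ^ 2)) 1 (by rw [← h0, hu]; module)
    exact one_ne_zero this.2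
  have hdu : ⟪K.dir, u⟫ = 0 := by
    rw [hu, inner_sub_right, inner_smul_right, real_inner_self_eq_norm_sq, div_mul_cancel₀ _ hd',
      sub_self]
  have huP : u ∈ Submodule.span ℝ {K.dir, K.side i} :=
    Submodule.sub_mem _ (Submodule.subset_span (by simp))
      (Submodule.smul_mem _ _ (Submodule.subset_span (by simp)))
  -- For concentric circles the two products in `h` and `h'` would be equal.
  have hD : q + q' - p - p' ≠ 0 := fun hD => by
    have : q' = p + p' - q := by linarith
    subst this
    nlinarith
  -- The radical axis of the two circles meets the line at parameter x, where both have the same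
  -- power. It is negative if the pairs interlace, so the circles meet above this point, off the
  -- line, which `circles_meet` forbids.
  set x := (q * q' - p * p') / (q + q' - p - p') with hx
  have h1 : x - p = (q - p) * (q' - p) / (q + q' - p - p') := by
    rw [hx]; field_simp; ring
  have h2 : x - p' = (q - p') * (q' - p') / (q + q' - p - p') := by
    rw [hx]; field_simp; ring
  have h3 : x - q = (p - q) * (q - p') / (q + q' - p - p') := by
    rw [hx]; field_simp; ring
  have h4 : x - q' = (p - q') * (q' - p') / (q + q' - p - p') := by
    rw [hx]; field_simp; ring
  have hY : 0 < -((x - p) * (x - p')) := by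
    have : -((x - p) * (x - p')) = -((q - p) * (q - p')) * ((q' - p) * (q' - p')) /
        (q + q' - p - p') ^ 2 := by
      rw [h1, h2]; field_simp
    rw [this]
    exact div_pos (mul_pos (neg_pos.2 h) h') (by positivity)
  have hYq : (x - q) * (x - q') = (x - p) * (x - p') := by
    rw [h1, h2, h3, h4]; field_simp; ring
  set r := √(-((x - p) * (x - p'))) * ‖K.dir‖ / ‖u‖ with hr
  have hu0' : ‖u‖ ≠ 0 := norm_ne_zero_iff.2 hu0
  have hnorm : ‖r • u‖ ^ 2 = -((x - p) * (x - p')) * ‖K.dir‖ ^ 2 := by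
    rw [norm_smul, mul_pow, Real.norm_eq_abs, sq_abs, hr, div_pow, mul_pow, Real.sq_sqrt hY.le]
    field_simp
  have hde : ⟪K.dir, r • u⟫ = 0 := by rw [inner_smul_right, hdu, mul_zero]
  have hrP := Submodule.smul_mem _ r huP
  have hne : circleOn (planeThrough K.origin K.dir (K.side i)) v (K.opp i v) ≠
      circleOn (planeThrough K.origin K.dir (K.side i)) w (K.opp i w) := fun hE => by
    have hw : K.origin + q • K.dir + 0 ∈
        circleOn (planeThrough K.origin K.dir (K.side i)) w (K.opp i w) := by
      rw [hq, hq', mem_circleOn_iff (Submodule.zero_mem _) (inner_zero_right _)]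
      simp
    rw [← hE, hp, hp', mem_circleOn_iff (Submodule.zero_mem _) (inner_zero_right _)] at hw
    have h5 := (mul_eq_zero.1 (by simpa using hw : (q - p) * (q - p') * ‖K.dir‖ ^ 2 = 0))
    exact h5.elim h.ne hd'
  have hmem : K.origin + x • K.dir + r • u ∈ K.nodes := by
    refine K.circles_meet i i v w hne ⟨?_, ?_⟩
    · rw [hp, hp', mem_circleOn_iff hrP hde, hnorm]
      ring
    · rw [hq, hq', mem_circleOn_iff hrP hde, hnorm, hYq]
      ring
  obtain ⟨a, ha⟩ := K.nodes_on_line _ hmem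
  have hru : r • u = (a - x) • K.dir := by
    have : r • u = K.origin + x • K.dir + r • u - (K.origin + x • K.dir) := by abel
    rw [this, ha]; module
  have h0 : ‖r • u‖ ^ 2 = 0 := by
    rw [← real_inner_self_eq_norm_sq]
    nth_rewrite 1 [hru]
    rw [inner_smul_left, hde, mul_zero]
  rw [hnorm] at h0
  exact (mul_eq_zero.1 h0).elim hY.ne' hd'

/-- The nodes can be coloured with two colours such that the two nodes on every circle have
different colours. -/
theorem exists_coloring : ∃ c : K.nodes → ℤˣ, ∀ i v, c (K.opp i v) = -c v := by
  choose pos hpos using fun v : K.nodes => K.nodes_on_line v v.2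
  have hinj : Function.Injective pos := fun v w h =>
    Subtype.ext (by rw [hpos v, hpos w, h])
  refine ⟨fun v => (-1) ^ (Finset.univ.filter (pos · < pos v)).card, fun i v =>
    neg_one_pow_card_eq_neg_of_involution hinj (K.opp_opp i) (K.opp_ne i) (fun v w h1 h2 => ?_) v⟩
  have hnc := K.circles_not_cross i v w (hpos v) (hpos _) (hpos w) (hpos _)
    (mul_neg_of_pos_of_neg (sub_pos.2 h1) (sub_neg.2 h2))
  have hn1 : pos (K.opp i w) ≠ pos v := fun h => by
    have := hinj h
    rw [← this, K.opp_opp] at h2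
    exact lt_irrefl _ h2
  have hn2 : pos (K.opp i w) ≠ pos (K.opp i v) := fun h => by
    have := congrArg (K.opp i) (hinj h)
    rw [K.opp_opp, K.opp_opp] at this
    rw [this] at h1
    exact lt_irrefl _ h1
  rcases lt_or_gt_of_ne hn1 with h3 | h3
  · exact absurd (mul_pos_of_neg_of_neg (sub_neg.2 h3) (sub_neg.2 (h3.trans (h1.trans h2)))) hnc
  · rcases lt_or_gt_of_ne hn2 with h4 | h4
    · exact ⟨h3, h4⟩
    · exact absurd (mul_pos (sub_pos.2 h3) (sub_pos.2 h4)) hnc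

end CFrame

/-! ### Incidence numbers and orientation -/

/-- The sign `(-1) ^ k`, where `k` is the number of non-zero entries of `s` before the `i`-th. -/
def dropSign {n : ℕ} (s : Fin n → SignType) (i : Fin n) : ℤˣ :=
  (-1) ^ (Finset.univ.filter fun j => j < i ∧ s j ≠ 0).card

/-- Omitting the earlier class lowers the count before the later one by one; omitting the later
class leaves the earlier count unchanged. -/
theorem dropSign_mul_dropSign {n : ℕ} {s : Fin n → SignType} {i j : Fin n} (hi : s i ≠ 0)
    (hj : s j ≠ 0) (hij : i ≠ j) :
    dropSign s i * dropSign (Function.update s i 0) j =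
      -(dropSign s j * dropSign (Function.update s j 0) i) := by
  wlog h : i < j generalizing i j
  · rw [this hj hi hij.symm (lt_of_le_of_ne (not_lt.1 h) hij.symm), neg_neg]
  have h1 : dropSign (Function.update s j 0) i = dropSign s i := by
    unfold dropSign
    congr 2
    ext l
    simp only [Finset.mem_filter, Finset.mem_univ, true_and]
    refine and_congr_right fun hl => ?_
    rw [Function.update_of_ne (hl.trans h).ne]
  have h2 : dropSign s j = -dropSign (Function.update s i 0) j := by
    have : (Finset.univ.filter fun l => l < j ∧ s l ≠ 0) =
        insert i (Finset.univ.filter fun l => l < j ∧ Function.update s i 0 l ≠ 0) := by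
      ext l
      simp only [Finset.mem_filter, Finset.mem_univ, true_and, Finset.mem_insert]
      by_cases hl : l = i
      · subst hl; simp [h, hi]
      · simp [hl]
    unfold dropSign
    rw [this, Finset.card_insert_of_notMem (by simp), pow_succ, mul_neg_one]
  rw [h1, h2, neg_mul, neg_neg, mul_comm]

namespace CFrame

variable {n : ℕ} {K : CFrame n}

namespace Face

/-- The incidence numbers that come from the ordering of the planes and a colouring of the nodes. -/
noncomputable def stdInc (c : K.nodes → ℤˣ) (F G : K.Face) : ℤˣ :=
  -- A vertex gets its colour, whatever the edge, so the two ends of an edge differ. For a facet of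
  -- positive dimension the product has a single factor.
  if G.dim = 0 then c G.exists_mem.choose
  else ∏ i with F.sgn i ≠ 0 ∧ G.sgn i = 0, dropSign F.sgn i

theorem eq_singleton_of_dim_eq_zero {G : K.Face} (hG : G.dim = 0) {v : K.nodes}
    (hv : v ∈ G.comp) : G.comp = {v} := by
  rw [G.comp_eq_component hv]
  refine Set.eq_singleton_iff_unique_mem.2 ⟨mem_component_self _ _, fun w hw => ?_⟩
  induction hw with
  | refl => rfl
  | tail _ h _ =>
    obtain ⟨i, hi, -⟩ := h
    exact absurd (dim_eq_zero_iff.1 hG i) hi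

theorem stdInc_of_dim_eq_zero (c : K.nodes → ℤˣ) (F : K.Face) {G : K.Face} (hG : G.dim = 0)
    {v : K.nodes} (hv : v ∈ G.comp) : stdInc c F G = c v := by
  rw [stdInc, if_pos hG]
  exact congrArg c ((eq_singleton_of_dim_eq_zero hG hv).le G.exists_mem.choose_spec)

theorem stdInc_of_dim_ne_zero (c : K.nodes → ℤˣ) {F G : K.Face} (hG : G.dim ≠ 0) {i : Fin n}
    (hi : F.sgn i ≠ 0) (h : G.sgn = Function.update F.sgn i 0) :
    stdInc c F G = dropSign F.sgn i := by
  rw [stdInc, if_neg hG]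
  have : (Finset.univ.filter fun j => F.sgn j ≠ 0 ∧ G.sgn j = 0) = {i} := by
    ext j
    simp only [Finset.mem_filter, Finset.mem_univ, true_and, Finset.mem_singleton, h]
    by_cases hj : j = i
    · subst hj; simp [hi]
    · simp [hj]
  rw [this, Finset.prod_singleton]

theorem stdInc_edge {c : K.nodes → ℤˣ} (hc : ∀ i v, c (K.opp i v) = -c v) {F H H' : K.Face}
    (hF : F.dim = 1) (hH : H < F ∧ F.dim = H.dim + 1) (hH' : H' < F ∧ F.dim = H'.dim + 1)
    (hne : H ≠ H') : stdInc c F H = -stdInc c F H' := by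
  obtain ⟨v, hv, hvF, i, hi, e⟩ := exists_facet_eq hH
  obtain ⟨w, hw, hwF, j, hj, e'⟩ := exists_facet_eq hH'
  have h0 : H.dim = 0 := by omega
  have h0' : H'.dim = 0 := by omega
  rw [stdInc_of_dim_eq_zero c F h0 hv, stdInc_of_dim_eq_zero c F h0' hw]
  obtain ⟨l, hl⟩ := Set.ncard_eq_one.1 (by exact hF : {i | F.sgn i ≠ 0}.ncard = 1)
  have hil : i = l := hl.le hi
  have hjl : j = l := hl.le hj
  subst hil
  subst hjl
  have hcases : ∀ x ∈ F.comp, x = w ∨ x = K.opp j w := by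
    rw [F.comp_eq_component hwF]
    intro x hx
    induction hx with
    | refl => exact .inl rfl
    | tail _ hxy ih =>
      obtain ⟨l, hl', rfl⟩ := hxy
      obtain rfl : l = j := hl.le hl'
      rcases ih with rfl | rfl
      · exact .inr rfl
      · exact .inl (K.opp_opp _ _)
  rcases hcases v hvF with rfl | rfl
  · exact absurd (e.trans e'.symm) hne
  · exact hc _ _

theorem stdInc_diamond (c : K.nodes → ℤˣ) {F G G' H : K.Face}
    (hG : G < F ∧ F.dim = G.dim + 1) (hG' : G' < F ∧ F.dim = G'.dim + 1)
    (hH : H < G ∧ G.dim = H.dim + 1) (hH' : H < G' ∧ G'.dim = H.dim + 1) (hne : G ≠ G') :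
    stdInc c F G * stdInc c G H = -(stdInc c F G' * stdInc c G' H) := by
  obtain ⟨v, hv⟩ := H.exists_mem
  obtain ⟨hvG, j, hj, ej⟩ := (facet_iff hv).1 hH
  obtain ⟨hvG', j', hj', ej'⟩ := (facet_iff hv).1 hH'
  obtain ⟨hvF, i, hi, ei⟩ := (facet_iff hvG).1 hG
  obtain ⟨-, i', hi', ei'⟩ := (facet_iff hvG').1 hG'
  have hii : i ≠ i' := by
    rintro rfl
    exact hne (by rw [G.eq_face hvG, G'.eq_face hvG', ei, ei'])
  have hji : j = i' := by
    by_contra hc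
    have h1 : H.sgn i' = F.sgn i' := by
      rw [ej, Function.update_of_ne (Ne.symm hc), ei, Function.update_of_ne hii.symm]
    have h2 : H.sgn i' = 0 := by
      rw [ej', ei']
      by_cases h : i' = j'
      · subst h; simp
      · rw [Function.update_of_ne h]; simp
    exact hi' (h1.symm.trans h2)
  have hji' : j' = i := by
    by_contra hc
    have h1 : H.sgn i = F.sgn i := by
      rw [ej', Function.update_of_ne (Ne.symm hc), ei', Function.update_of_ne hii]
    have h2 : H.sgn i = 0 := by
      rw [ej, ei]
      by_cases h : i = j
      · subst h; simp
      · rw [Function.update_of_ne h]; simp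
    exact hi (h1.symm.trans h2)
  subst hji
  subst hji'
  have key := dropSign_mul_dropSign hi hi' hii
  rw [stdInc_of_dim_ne_zero c (by omega) hi ei, stdInc_of_dim_ne_zero c (by omega) hi' ei']
  by_cases h0 : H.dim = 0
  · rw [stdInc_of_dim_eq_zero c G h0 hv, stdInc_of_dim_eq_zero c G' h0 hv]
    have hz := dim_eq_zero_iff.1 h0
    have h1 : ∀ {s : Fin n → SignType} {i : Fin n}, H.sgn = Function.update s i 0 →
        dropSign s i = 1 := fun {s i} e => by
      rw [dropSign, Finset.card_eq_zero.2, pow_zero]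
      refine Finset.filter_eq_empty_iff.2 fun l _ ⟨hl, hs⟩ => hs ?_
      have := hz l
      rwa [e, Function.update_of_ne hl.ne] at this
    rw [← ei, ← ei', h1 ej, h1 ej', mul_one, mul_one] at key
    rw [key, neg_mul]
  · rw [stdInc_of_dim_ne_zero c h0 hj ej, stdInc_of_dim_ne_zero c h0 hj' ej', ei, ei']
    exact key

/-- Signs of pairs of a cell and a facet that are compatible with edges and diamonds come from
signs of the cells. -/
theorem exists_sign_of_cocycle {δ : K.Face → K.Face → ℤˣ}
    (hedge : ∀ F H H' : K.Face, F.dim = 1 → (H < F ∧ F.dim = H.dim + 1) →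
      (H' < F ∧ F.dim = H'.dim + 1) → δ F H = δ F H')
    (hdiamond : ∀ F G G' H : K.Face, (G < F ∧ F.dim = G.dim + 1) → (G' < F ∧ F.dim = G'.dim + 1) →
      (H < G ∧ G.dim = H.dim + 1) → (H < G' ∧ G'.dim = H.dim + 1) →
      δ F G * δ G H = δ F G' * δ G' H) :
    ∃ η : K.Face → ℤˣ, ∀ F G : K.Face, (G < F ∧ F.dim = G.dim + 1) → δ F G = η F * η G := by
  classical
  -- Induction over skeleta, with η normalized to 1 on vertices. The value at a new cell is read off
  -- from any facet; the point is independence of the facet.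
  suffices h : ∀ k, ∃ η : K.Face → ℤˣ, (∀ F : K.Face, F.dim = 0 → η F = 1) ∧
      ∀ F G : K.Face, F.dim ≤ k → (G < F ∧ F.dim = G.dim + 1) → δ F G = η F * η G by
    obtain ⟨η, -, h⟩ := h n
    exact ⟨η, fun F G => h F G F.dim_le⟩
  intro k
  induction k with
  | zero => exact ⟨1, fun _ _ => rfl, fun F G h h' => by omega⟩
  | succ k ih =>
    obtain ⟨η, h0, hη⟩ := ih
    have hconst : ∀ F : K.Face, F.dim = k + 1 → ∀ G G' : K.Face, (G < F ∧ F.dim = G.dim + 1) →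
        (G' < F ∧ F.dim = G'.dim + 1) → δ F G * η G = δ F G' * η G' := by
      intro F hF G G' hG hG'
      rcases Nat.eq_zero_or_pos k with rfl | hk
      · rw [h0 G (by omega), h0 G' (by omega), hedge F G G' hF hG hG']
      -- Two facets through the same node, omitting classes i and j, share the face that omits both.
      have hstep : ∀ (v : K.nodes), v ∈ F.comp → ∀ i j, F.sgn i ≠ 0 → F.sgn j ≠ 0 →
          δ F (face (Function.update F.sgn i 0) v) * η (face (Function.update F.sgn i 0) v) =
          δ F (face (Function.update F.sgn j 0) v) * η (face (Function.update F.sgn j 0) v) := by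
        intro v hv i j hi hj
        by_cases hij : i = j
        · rw [hij]
        have hGi := facet_face hv hi
        have hGj := facet_face hv hj
        have hHi := facet_face (F := face (Function.update F.sgn i 0) v) (mem_face _ v) (i := j)
          (by simpa [face, Ne.symm hij] using hj)
        have hHj := facet_face (F := face (Function.update F.sgn j 0) v) (mem_face _ v) (i := i)
          (by simpa [face, hij] using hi)
        have hcomm : Function.update (face (Function.update F.sgn j 0) v).sgn i 0 =
            Function.update (face (Function.update F.sgn i 0) v).sgn j 0 :=
          Function.update_comm (Ne.symm hij) _ _ _
        rw [hcomm] at hHj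
        have hd := hdiamond _ _ _ _ hGi hGj hHi hHj
        rw [hη _ _ (by omega) hHi, hη _ _ (by omega) hHj, ← mul_assoc, ← mul_assoc] at hd
        exact mul_right_cancel hd
      have hmove : ∀ (v : K.nodes), v ∈ F.comp → ∀ w ∈ F.comp, ∀ i j, F.sgn i ≠ 0 → F.sgn j ≠ 0 →
          δ F (face (Function.update F.sgn i 0) v) * η (face (Function.update F.sgn i 0) v) =
          δ F (face (Function.update F.sgn j 0) w) * η (face (Function.update F.sgn j 0) w) := by
        intro v hv w hw
        rw [F.comp_eq_component hv] at hw
        induction hw with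
        | refl => exact hstep v hv
        | @tail x y hx hxy ih =>
          intro i j hi hj
          obtain ⟨l, hl, rfl⟩ := hxy
          have hxF : x ∈ F.comp := by rw [F.comp_eq_component hv]; exact hx
          -- A facet omitting a class m ≠ l contains the whole circle from x to its opposite, so it
          -- serves both nodes; such m exists as the cell has dimension at least 2.
          obtain ⟨m, hm, hml⟩ := Set.exists_ne_of_one_lt_ncard
            (by have : {i | F.sgn i ≠ 0}.ncard = k + 1 := hF
                omega : 1 < {i | F.sgn i ≠ 0}.ncard) l
          have heq : face (Function.update F.sgn m 0) (K.opp l x) =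
              face (Function.update F.sgn m 0) x := by
            refine ((face (Function.update F.sgn m 0) x).eq_face
              (opp_mem _ (mem_face _ x) ?_)).symm
            simpa [face, hml.symm] using hl
          rw [ih i m hi hm, ← heq]
          exact hstep _ (F.opp_mem hxF hl) m j hm hj
      obtain ⟨v, -, hvF, i, hi, rfl⟩ := exists_facet_eq hG
      obtain ⟨w, -, hwF, j, hj, rfl⟩ := exists_facet_eq hG'
      exact hmove v hvF w hwF i j hi hj
    refine ⟨fun F => if F.dim = k + 1 then
      if h : ∃ G : K.Face, G < F ∧ F.dim = G.dim + 1 then δ F h.choose * η h.choose else 1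
      else η F, fun F hF => ?_, fun F G hF hG => ?_⟩
    · simp only
      rw [if_neg (by omega), h0 F hF]
    · have hGk : G.dim ≠ k + 1 := by omega
      simp only [if_neg hGk]
      by_cases hFk : F.dim = k + 1
      · have hex : ∃ G : K.Face, G < F ∧ F.dim = G.dim + 1 := ⟨G, hG⟩
        rw [if_pos hFk, dif_pos hex, ← hconst F hFk G _ hG hex.choose_spec, mul_assoc,
          Int.units_mul_self, mul_one]
      · rw [if_neg hFk]
        exact hη F G (by omega) hG

/-- The product of the signs of a cell. -/
def totalSign (F : K.Face) : ℤˣ := ∏ i, if F.sgn i = -1 then -1 else 1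

theorem totalSign_eq_neg {F F' : K.Face} {i : Fin n} (hi : F.sgn i ≠ 0) (hi' : F'.sgn i ≠ 0)
    (hne : F.sgn i ≠ F'.sgn i) (h : ∀ j, j ≠ i → F.sgn j = F'.sgn j) :
    F.totalSign = -F'.totalSign := by
  rw [totalSign, totalSign, Fintype.prod_eq_mul_prod_compl i, Fintype.prod_eq_mul_prod_compl i,
    ← neg_mul]
  congr 1
  · cases h1 : F.sgn i <;> cases h2 : F'.sgn i <;> simp_all
  · refine Finset.prod_congr rfl fun j hj => ?_
    rw [h j (by simpa using hj)]

/-- Both cells use all planes, so their incidence with `G` is the same number, while their signs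
differ in exactly the plane that `G` omits. -/
theorem stdInc_orientation (c : K.nodes → ℤˣ) {F F' G : K.Face} (hF : F.dim = n) (hF' : F'.dim = n)
    (hG : G < F ∧ F.dim = G.dim + 1) (hG' : G < F' ∧ F'.dim = G.dim + 1) (hne : F ≠ F') :
    F.totalSign * stdInc c F G = -(F'.totalSign * stdInc c F' G) := by
  obtain ⟨v, hv⟩ := G.exists_mem
  obtain ⟨hvF, i, hi, ei⟩ := (facet_iff hv).1 hG
  obtain ⟨hvF', i', hi', ei'⟩ := (facet_iff hv).1 hG'
  have hFs := dim_eq_iff.1 hF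
  have hFs' := dim_eq_iff.1 hF'
  have hii : i = i' := by
    by_contra hc
    have h1 : G.sgn i = 0 := by simp [ei]
    rw [ei', Function.update_of_ne hc] at h1
    exact hFs' i h1
  subst hii
  have hsame : ∀ j, j ≠ i → F.sgn j = F'.sgn j := fun j hj => by
    have := congrFun (ei.symm.trans ei') j
    rwa [Function.update_of_ne hj, Function.update_of_ne hj] at this
  have hdiff : F.sgn i ≠ F'.sgn i := fun h => hne (by
    have : F.sgn = F'.sgn := funext fun j => by
      by_cases hj : j = i
      · rw [hj, h]
      · exact hsame j hj
    rw [F.eq_face hvF, F'.eq_face hvF', this])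
  have hinc : stdInc c F G = stdInc c F' G := by
    simp [stdInc, dropSign, hFs, hFs']
  rw [totalSign_eq_neg hi hi' hdiff hsame, hinc, neg_mul]

end Face

theorem SpanningComplex.isOrientable (S : K.SpanningComplex) :
    S.toCellComplex.IsOrientable n := by
  obtain ⟨c, hc⟩ := K.exists_coloring
  have hstd : S.toCellComplex.IsIncidence (Face.stdInc c) := by
    refine ⟨fun F H H' hF hH hH' hne => ?_, fun F G G' H hG hG' hH hH' hne => ?_⟩
    · rw [S.isFacet_iff] at hH hH'
      rw [S.dim_eq] at hF
      exact Face.stdInc_edge hc hF hH hH' hne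
    · rw [S.isFacet_iff] at hG hG' hH hH'
      exact Face.stdInc_diamond c hG hG' hH hH' hne
  refine ⟨⟨_, hstd⟩, fun inc hinc => ?_⟩
  obtain ⟨η, hη⟩ := Face.exists_sign_of_cocycle (K := K)
    (δ := fun F G => inc F G * Face.stdInc c F G) (fun F H H' hF hH hH' => by
      by_cases hne : H = H'
      · rw [hne]
      rw [← S.isFacet_iff] at hH hH'
      rw [← S.dim_eq] at hF
      rw [hinc.edge F H H' hF hH hH' hne, hstd.edge F H H' hF hH hH' hne, neg_mul_neg])
    (fun F G G' H hG hG' hH hH' => by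
      by_cases hne : G = G'
      · rw [hne]
      rw [← S.isFacet_iff] at hG hG' hH hH'
      rw [mul_mul_mul_comm, hinc.diamond F G G' H hG hG' hH hH' hne,
        hstd.diamond F G G' H hG hG' hH hH' hne, neg_mul_neg, mul_mul_mul_comm])
  have hη' : ∀ F G, S.toCellComplex.IsFacet G F → inc F G = η F * η G * Face.stdInc c F G := by
    intro F G hG
    rw [← hη F G (S.isFacet_iff.1 hG), mul_assoc, Int.units_mul_self, mul_one]
  -- The factor η F cancels, and the remaining η G is common to both cells.
  refine ⟨fun F => η F * F.totalSign, fun F F' G hF hF' hG hG' hne => ?_⟩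
  rw [hη' F G hG, hη' F' G hG']
  rw [S.dim_eq] at hF hF'
  have key := Face.stdInc_orientation c hF hF' (S.isFacet_iff.1 hG) (S.isFacet_iff.1 hG') hne
  have h1 : ∀ a b t s : ℤˣ, a * t * (a * b * s) = b * (t * s) := fun a b t s => by
    calc a * t * (a * b * s) = (a * a) * (b * (t * s)) := by
          simp only [mul_comm, mul_left_comm]
      _ = _ := by rw [Int.units_mul_self, one_mul]
  rw [h1, h1, key, mul_neg]

end CFrame

/-! ### Cofacets, chains and stars of cells -/

namespace CFrame

variable {n : ℕ} {K : CFrame n}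

namespace Face

theorem ncard_cofacets {G : K.Face} (hG : G.dim + 1 = n) :
    {F : K.Face | G < F ∧ F.dim = G.dim + 1}.ncard = 2 := by
  obtain ⟨v, hv⟩ := G.exists_mem
  have h1 : {i | G.sgn i ≠ 0}ᶜ.ncard = 1 := by
    rw [Set.ncard_compl, Nat.card_fin]
    have : {i | G.sgn i ≠ 0}.ncard + 1 = n := hG
    omega
  obtain ⟨i, hi⟩ := Set.ncard_eq_one.1 h1
  have hi0 : G.sgn i = 0 := by
    simpa using hi.ge (Set.mem_singleton i)
  have hset : {F : K.Face | G < F ∧ F.dim = G.dim + 1} =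
      {face (Function.update G.sgn i 1) v, face (Function.update G.sgn i (-1)) v} := by
    ext F
    rw [Set.mem_ofPred_eq, facet_iff hv, Set.mem_insert_iff, Set.mem_singleton_iff]
    constructor
    · rintro ⟨hvF, j, hj, e⟩
      obtain rfl : j = i := hi.le (by simp [e])
      have hF : F.sgn = Function.update G.sgn j (F.sgn j) := by
        rw [e, Function.update_idem, Function.update_eq_self]
      rw [F.eq_face hvF]
      cases hs : F.sgn j
      · exact absurd hs hj
      · right
        rw [hF, hs]; rfl
      · left
        rw [hF, hs]; rfl
    · have key : ∀ t : SignType, t ≠ 0 → v ∈ (face (Function.update G.sgn i t) v).comp ∧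
          ∃ j, (face (Function.update G.sgn i t) v).sgn j ≠ 0 ∧
            G.sgn = Function.update (face (Function.update G.sgn i t) v).sgn j 0 := by
        intro t ht
        refine ⟨mem_face _ v, i, by simpa [face] using ht, ?_⟩
        simp only [face, Function.update_idem]
        rw [← hi0, Function.update_eq_self]
      rintro (rfl | rfl) <;> exact key _ (by decide)
  rw [hset, Set.ncard_pair]
  intro h
  have := congrFun (congrArg Face.sgn h) i
  simp [face] at this

/-- Signs are changed one plane at a time; consecutive cells share the facets that omit this plane.
-/
theorem reflTransGen_neighbours (F F' : K.Face) (hF : F.dim = n) (hF' : F'.dim = n) :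
    Relation.ReflTransGen (fun F F' : K.Face => F.dim = n ∧ F'.dim = n ∧
      ∃ G : K.Face, (G < F ∧ F.dim = G.dim + 1) ∧ (G < F' ∧ F'.dim = G.dim + 1)) F F' := by
  have hs' := dim_eq_iff.1 hF'
  induction h : (Finset.univ.filter fun i => F.sgn i ≠ F'.sgn i).card generalizing F with
  | zero =>
    have hs := dim_eq_iff.1 hF
    have hsgn : F.sgn = F'.sgn := funext fun i => by
      by_contra hc
      exact Finset.filter_eq_empty_iff.1 (Finset.card_eq_zero.1 h) (Finset.mem_univ i) hc
    rw [Face.ext hsgn ((comp_eq_univ hs).trans (comp_eq_univ hs').symm)]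
  | succ m ih =>
    have hs := dim_eq_iff.1 hF
    obtain ⟨v, hv⟩ := F.exists_mem
    obtain ⟨i, hi⟩ := Finset.card_pos.1 (by omega :
      0 < (Finset.univ.filter fun i => F.sgn i ≠ F'.sgn i).card)
    let F₁ : K.Face := face (Function.update F.sgn i (F'.sgn i)) v
    have hs₁ : ∀ j, F₁.sgn j ≠ 0 := fun j => by
      by_cases hj : j = i
      · subst hj; simpa [F₁, face] using hs' j
      · simpa [F₁, face, hj] using hs j
    have hF₁ : F₁.dim = n := dim_eq_iff.2 hs₁
    have hG := facet_face hv (hs i)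
    have hG₁ := facet_face (F := F₁) (mem_face _ v) (hs₁ i)
    have e : Function.update F₁.sgn i 0 = Function.update F.sgn i 0 := Function.update_idem _ _ _
    rw [e] at hG₁
    refine .head ⟨hF, hF₁, _, hG, hG₁⟩ (ih F₁ hF₁ ?_)
    have hcard : (Finset.univ.filter fun j => F.sgn j ≠ F'.sgn j) =
        insert i (Finset.univ.filter fun j => F₁.sgn j ≠ F'.sgn j) := by
      ext j
      by_cases hj : j = i
      · subst hj; simpa using hi
      · simp [F₁, face, hj]
    rw [hcard, Finset.card_insert_of_notMem (by simp [F₁, face])] at h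
    omega

theorem exists_le_dim_eq (F : K.Face) : ∃ F' : K.Face, F ≤ F' ∧ F'.dim = n := by
  obtain ⟨v, hv⟩ := F.exists_mem
  refine ⟨face (fun i => if F.sgn i = 0 then 1 else F.sgn i) v,
    (le_iff hv).2 ⟨mem_face _ v, fun i hi => (if_neg hi).symm⟩, dim_eq_iff.2 fun i => ?_⟩
  by_cases hi : F.sgn i = 0 <;> simp [face, hi]

/-- Any two cells are joined by a chain of cells, consecutive ones being related by inclusion. -/
theorem reflTransGen_le (F F' : K.Face) :
    Relation.ReflTransGen (fun G H : K.Face => G ≤ H ∨ H ≤ G) F F' := by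
  have hvert : ∀ (F : K.Face) (v : K.nodes), v ∈ F.comp → face 0 v ≤ F := fun F v hv =>
    (le_iff (mem_face 0 v)).2 ⟨hv, fun i hi => absurd rfl hi⟩
  obtain ⟨v, hv⟩ := F.exists_mem
  obtain ⟨w, hw⟩ := F'.exists_mem
  have hvw : Relation.ReflTransGen (fun G H : K.Face => G ≤ H ∨ H ≤ G) (face 0 v) (face 0 w) := by
    have h := K.connected v w
    clear hw
    induction h with
    | refl => exact .refl
    | @tail x y _ hxy ih =>
      obtain ⟨i, rfl⟩ := hxy
      have hy : K.opp i x ∈ (face (Pi.single i 1) x).comp :=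
        opp_mem _ (mem_face _ x) (by simp [face])
      exact (ih.tail (.inl (hvert _ x (mem_face (Pi.single i 1) x)))).tail (.inr (hvert _ _ hy))
  exact (Relation.ReflTransGen.head (.inr (hvert F v hv)) hvw).tail (.inl (hvert F' w hw))

/-- The cells that contain a given cell, in terms of their signs in the remaining planes. -/
def extend (F : K.Face) (v : K.nodes) (s : {i // F.sgn i = 0} → SignType) : K.Face :=
  face (fun i => if h : F.sgn i = 0 then s ⟨i, h⟩ else F.sgn i) v

/-- This and `exists_extend_eq` identify the star of `F` with the sign vectors, as the charts need.
-/
theorem extend_le_extend (F : K.Face) (v : K.nodes) (s t : {i // F.sgn i = 0} → SignType) :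
    F.extend v s ≤ F.extend v t ↔ ∀ i, s i ≠ 0 → s i = t i := by
  rw [extend, extend, face_le_face]
  constructor
  · intro h i hi
    have := h i
    simp only [i.2, dif_pos] at this
    exact this hi
  · intro h i
    by_cases hi : F.sgn i = 0
    · simpa [hi] using h ⟨i, hi⟩
    · simp [hi]

theorem extend_zero (F : K.Face) {v : K.nodes} (hv : v ∈ F.comp) : F.extend v 0 = F := by
  have : (fun i => if h : F.sgn i = 0 then (0 : {i // F.sgn i = 0} → SignType) ⟨i, h⟩
      else F.sgn i) = F.sgn := funext fun i => by
    by_cases hi : F.sgn i = 0 <;> simp [hi]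
  rw [extend, this, ← F.eq_face hv]

theorem exists_extend_eq (F : K.Face) {v : K.nodes} (hv : v ∈ F.comp) {G : K.Face} (hG : F ≤ G) :
    ∃ s, F.extend v s = G := by
  refine ⟨fun i => G.sgn i, ?_⟩
  have : (fun i => if F.sgn i = 0 then G.sgn i else F.sgn i) = G.sgn := funext fun i => by
    by_cases hi : F.sgn i = 0
    · simp [hi]
    · rw [if_neg hi]; exact hG.2 i hi
  rw [G.eq_face (hG.1 hv), extend]
  exact congrArg (face · v) this

theorem dim_add_card (F : K.Face) : F.dim + Fintype.card {i // F.sgn i = 0} = n := by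
  have h := Set.ncard_add_ncard_compl {i | F.sgn i ≠ 0}
  rw [Nat.card_fin] at h
  rw [Face.dim, ← Nat.card_eq_fintype_card]
  convert h using 2
  rw [← Nat.card_coe_set_eq]
  simp [Set.compl_def, Fintype.card_subtype]

end Face

/-! ### The surface as a closed manifold -/

namespace SpanningComplex

open CellComplex

variable (S : K.SpanningComplex)

theorem surface_eq_support : S.surface = S.support := by
  ext x
  simp only [surface, sSurface, support, Set.mem_iUnion]
  constructor
  · rintro ⟨_, F, _, hx⟩
    exact ⟨F, hx⟩
  · rintro ⟨F, hx⟩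
    -- Planes that the cell does not use may get any sign; here +1.
    refine ⟨fun i => if F.sgn i = -1 then -1 else 1, F, fun i hi => ?_, hx⟩
    cases h : F.sgn i <;> simp_all

theorem isConnected_support : IsConnected S.support := by
  obtain ⟨v, hv⟩ := K.nodes_nonempty
  have : Nonempty K.Face := ⟨face 0 ⟨v, hv⟩⟩
  refine IsConnected.iUnion_of_reflTransGen (fun F => (S.isCell F).isConnected) fun F G => ?_
  refine Relation.ReflTransGen.mono (fun G H h => ?_) _ _ (Face.reflTransGen_le F G)
  rcases h with h | h
  · obtain ⟨x, hx⟩ := (S.isCell G).isConnected.nonempty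
    exact ⟨x, hx, cell_subset h hx⟩
  · obtain ⟨x, hx⟩ := (S.isCell H).isConnected.nonempty
    exact ⟨x, cell_subset h hx, hx⟩

theorem nonempty_chartedSpace :
    Nonempty (ChartedSpace (EuclideanSpace ℝ (Fin n)) S.support) := by
  refine nonempty_chartedSpace_of_forall fun x => ?_
  obtain ⟨F, hF⟩ := exists_mem_interior x.2
  obtain ⟨v, hv⟩ := F.exists_mem
  have h0 := F.extend_zero hv
  obtain ⟨e, he, hx⟩ := S.exists_isOpenEmbedding (φ := F.extend v) (F.extend_le_extend v)
    fun G hG => F.exists_extend_eq hv (h0 ▸ hG)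
  refine exists_openPartialHomeomorph ?_ he (hx x (by rwa [h0]))
  rw [S.dim_eq, h0, F.dim_add_card]

theorem isClosedCellularManifold : S.toCellComplex.IsClosedCellularManifold n where
  isCompact := isCompact_iUnion fun F => (S.isCell F).isCompact
  isConnected := S.isConnected_support
  locallyEuclidean := S.nonempty_chartedSpace
  dim_le F := by rw [S.dim_eq]; exact F.dim_le
  pure F := by
    obtain ⟨F', h, h'⟩ := F.exists_le_dim_eq
    exact ⟨F', h, by rw [S.dim_eq, h']⟩
  chain F F' hF hF' := by
    rw [S.dim_eq] at hF hF'
    refine Relation.ReflTransGen.mono (fun F F' h => ?_) _ _ (Face.reflTransGen_neighbours F F' hF hF')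
    obtain ⟨h1, h2, G, h3, h4⟩ := h
    exact ⟨by rw [S.dim_eq, h1], by rw [S.dim_eq, h2], G, S.isFacet_iff.2 h3, S.isFacet_iff.2 h4⟩
  two_cells G hG := by
    rw [S.dim_eq] at hG
    simp only [S.isFacet_iff]
    exact Face.ncard_cofacets hG

end SpanningComplex

end CFrame

theorem mainTheorem3 {n : ℕ} (hn : 1 ≤ n) (K : CFrame n) (S : K.SpanningComplex) :
    S.surface = S.support ∧
      S.toCellComplex.IsClosedCellularManifold n ∧
      S.toCellComplex.IsOrientable n :=
  ⟨S.surface_eq_support, S.isClosedCellularManifold, S.isOrientable⟩
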